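/- **Setting.** There are $N$ agents with costs $J_k:\mathbb R^M\to\mathbb R$ and minimizers $w_k^o$ ($k=1,\dots,N$), and $\mathcal W^o=\mathrm{col}\{w_1^o,\dots,w_N^o\}\in\mathbb R^{NM}$. The agents are partitioned into groups $\mathcal G_1,\dots,\mathcal G_G$, with $N_m^g=|\mathcal G_m|$; agents of one group have the same minimizer, and each group is connected through the neighborhoods $\mathcal N_k\ni k$ of its agents. $\|\cdot\|$ is the Euclidean norm of vectors and the 2-induced norm of matrices. *Combination weights.* $a_{\ell k}>0$ if $\ell\in\mathcal N_k$ and $\ell,k$ are in the same group, $a_{\ell k}=0$ otherwise, and $\sum_\ell a_{\ell k}=1$ for all $k$. For every group $\mathcal G_m$, the vector $(p_k)_{k\in\mathcal G_m}$ satisfies $\sum_{k\in\mathcal G_m}a_{\ell k}p_k=p_\ell$ for $\ell\in\mathcal G_m$ and $\sum_{k\in\mathcal G_m}p_k=1$ (the Perron vector of the group). *Costs.* Each $J_k$ is strictly convex and twice differentiable, with $\lambda_{k,L}I\le\nabla^2J_k(w)\le\lambda_{k,U}I$ for all $w$, where $0\le\lambda_{k,L}\le\lambda_{k,U}<\infty$;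 each group contains an agent with $\lambda_{k,L}>0$; and $\mathcal W\mapsto\mathrm{diag}\{\nabla^2J_1(w_1),\dots,\nabla^2J_N(w_N)\}$ is Lipschitz. Put $H_k=\nabla^2J_k(w_k^o)$. *Gradient noise.* Let $\{\mathbb F_i\}$ be a filtration of a probability space, and let $\widehat{\nabla J_k}$ be the random approximation of $\nabla J_k$ used at iteration $i$, with network noise $\mathcal S_i(\mathcal W)=\mathrm{col}\{\widehat{\nabla J_k}(w_k)-\nabla J_k(w_k)\}_{k=1}^N$; the approximations and the constants below do not depend on the step-sizes. For every $i\ge0$ and every $\mathbb F_{i-1}$-measurable $\mathcal W$ with $\mathbb E\|\mathcal W\|^4<\infty$, the vector $\mathcal S_i(\mathcal W)$ is $\mathbb F_i$-measurable with finite fourth moment and, almost surely, with $\mathcal R_{s,i}(\mathcal W)=\mathbb E[\mathcal S_i(\mathcal W)\mathcal S_i(\mathcal W)^{\mathsf T}\mid\mathbb F_{i-1}]$, $$\mathbb E[\mathcal S_i(\mathcal W)\mid\mathbb F_{i-1}]=0,\qquad \mathbb E[\|\mathcal S_i(\mathcal W)\|^4\mid\mathbb F_{i-1}]\le\alpha^2\|\mathcal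 W^o-\mathcal W\|^4+\sigma_s^4,$$ $$\|\mathcal R_{s,i}(\mathcal W^o)-\mathcal R_{s,i}(\mathcal W)\|\le\kappa_s\|\mathcal W^o-\mathcal W\|^{\gamma_s},$$ with constants $\alpha,\sigma_s,\kappa_s\ge0$ and $0<\gamma_s\le4$. Moreover $\mathcal R_{s,i}(\mathcal W^o)\to\mathcal R_s$ almost surely as $i\to\infty$, where $\mathcal R_s$ is a constant symmetric positive definite matrix. Let $R_{k\ell}$ be the $(k,\ell)$-th $M\times M$ block of $\mathcal R_s$, and $R_k=R_{kk}$. *Algorithm.* For step-sizes $\mu_k>0$ with $\mu_{\max}=\max_k\mu_k$, put $w_{k,-1}=0$ and, for $i\ge0$ and $k\in\mathcal G_m$, $$\psi_{k,i}=w_{k,i-1}-\mu_k\widehat{\nabla J_k}(w_{k,i-1}),\qquad w_{k,i}=\sum_{\ell\in\mathcal N_k\cap\mathcal G_m}a_{\ell k}\psi_{\ell,i},$$ and $\widetilde{\mathcal W}_i=\mathcal W^o-\mathrm{col}\{w_{1,i},\dots,w_{N,i}\}$. The limit $\mu_{\max}\to0$ is taken with the ratios $\mu_k/\mu_{\max}$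 fixed; the right-hand sides below depend only on these ratios. **Lemma (Steady-state normalized MSD).** The normalized total MSD is $$\lim_{\mu_{\max}\to0}\limsup_{i\to\infty}\mu_{\max}^{-1}\mathbb E\|\widetilde{\mathcal W}_i\|^2=\sum_{m=1}^G\frac{N_m^g}{2\mu_{\max}}\mathrm{Tr}\Big[\Big(\sum_{k\in\mathcal G_m}p_k\mu_kH_k\Big)^{-1}\Big(\sum_{k,\ell\in\mathcal G_m}p_kp_\ell\mu_k\mu_\ell R_{k\ell}\Big)\Big].$$ In particular, if the noises of distinct agents of the same group are asymptotically uncorrelated, that is, $R_{k\ell}=0$ whenever $k\ne\ell$ are in the same group, then $$\lim_{\mu_{\max}\to0}\limsup_{i\to\infty}\mu_{\max}^{-1}\mathbb E\|\widetilde{\mathcal W}_i\|^2=\sum_{m=1}^G\frac{N_m^g}{2\mu_{\max}}\mathrm{Tr}\Big[\Big(\sum_{k\in\mathcal G_m}p_k\mu_kH_k\Big)^{-1}\Big(\sum_{k\in\mathcal G_m}p_k^2\mu_k^2R_k\Big)\Big].$$ -/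

import Mathlib

open MeasureTheory ProbabilityTheory Filter Topology
open scoped ENNReal Matrix.Norms.L2Operator

/-- Network vectors `col{w₁, …, w_N}` with blocks `w_k ∈ ℝ^M`, under the Euclidean norm of `ℝ^{NM}`. -/
abbrev NetVec (N M : ℕ) : Type := PiLp 2 (fun _ : Fin N => EuclideanSpace ℝ (Fin M))

/-- Network matrices, of size `NM × NM`; `‖·‖` is the 2-induced norm. -/
abbrev NetMat (N M : ℕ) : Type := Matrix (Fin N × Fin M) (Fin N × Fin M) ℝ

/-- The `(k, l)` block, of size `M × M`, of a network matrix. -/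
def NetMat.block {N M : ℕ} (R : NetMat N M) (k l : Fin N) : Matrix (Fin M) (Fin M) ℝ :=
  Matrix.of fun a b => R (k, a) (l, b)

/-- The Hessian matrix of `f` at `w`: its `(a, b)` entry is `∂_b (∇ f)_a`. -/
noncomputable def hessianMatrix {M : ℕ} (f : EuclideanSpace ℝ (Fin M) → ℝ)
    (w : EuclideanSpace ℝ (Fin M)) : Matrix (Fin M) (Fin M) ℝ :=
  Matrix.of fun a b => (fderiv ℝ (gradient f) w (EuclideanSpace.single b 1)) a

/-- The network Hessian `diag{∇²J₁(w₁), …, ∇²J_N(w_N)}`. -/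
noncomputable def networkHessian {N M : ℕ} (J : Fin N → EuclideanSpace ℝ (Fin M) → ℝ)
    (W : NetVec N M) : NetMat N M :=
  Matrix.of fun x y => if x.1 = y.1 then hessianMatrix (J x.1) (W x.1) x.2 y.2 else 0

/-- The agents of group `m`. -/
def groupAgents {N G : ℕ} (group : Fin N → Fin G) (m : Fin G) : Finset (Fin N) :=
  Finset.univ.filter fun k => group k = m

/-- The groups partition the agents (agent `k` is in group `group k`); the agents of a group share
one minimizer, that is, they lie in one cluster; and every group is connected through the
neighborhoods `nbr k ∋ k` of its own agents. Links may be one-way, and then connectedness means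
that every agent of the group can reach every other one; for symmetric neighborhoods this is
ordinary connectedness. -/
structure IsGrouping {N M G : ℕ} (nbr : Fin N → Finset (Fin N)) (group : Fin N → Fin G)
    (wo : NetVec N M) : Prop where
  self_mem : ∀ k, k ∈ nbr k
  same_cluster : ∀ k l, group k = group l → wo k = wo l
  connected : ∀ k l, group k = group l →
    Relation.ReflTransGen (fun a b => a ∈ nbr b ∧ group a = group b) k l

/-- Combination weights `A l k = a_{lk}`: positive exactly for the neighbors `l` of `k` in the group
of `k`, and every column sums to one. -/
structure IsCombination {N G : ℕ} (nbr : Fin N → Finset (Fin N)) (group : Fin N → Fin G)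
    (A : Matrix (Fin N) (Fin N) ℝ) : Prop where
  pos : ∀ l k, l ∈ nbr k → group l = group k → 0 < A l k
  zero : ∀ l k, ¬ (l ∈ nbr k ∧ group l = group k) → A l k = 0
  col_sum : ∀ k, ∑ l, A l k = 1

/-- `p` stacks the right eigenvectors, at the eigenvalue one, of the diagonal blocks of `A` that
belong to the groups, each normalized so that its entries add up to one. -/
structure IsPerronVector {N G : ℕ} (group : Fin N → Fin G) (A : Matrix (Fin N) (Fin N) ℝ)
    (p : Fin N → ℝ) : Prop where
  eigen : ∀ m, ∀ l ∈ groupAgents group m, ∑ k ∈ groupAgents group m, A l k * p k = p l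
  sum_one : ∀ m, ∑ k ∈ groupAgents group m, p k = 1

/-- The conditions on the individual costs `J k` with minimizers `wo k`. -/
structure CostAssumption {N M G : ℕ} (group : Fin N → Fin G)
    (J : Fin N → EuclideanSpace ℝ (Fin M) → ℝ) (wo : NetVec N M) : Prop where
  minimizer : ∀ k, IsMinOn (J k) Set.univ (wo k)
  strictConvex : ∀ k, StrictConvexOn ℝ Set.univ (J k)
  differentiable : ∀ k, Differentiable ℝ (J k)
  twice_differentiable : ∀ k, Differentiable ℝ (gradient (J k))
  hessian_bounds : ∃ lamL lamU : Fin N → ℝ,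
    (∀ k, 0 ≤ lamL k ∧ lamL k ≤ lamU k ∧ ∀ w,
      (hessianMatrix (J k) w - lamL k • (1 : Matrix (Fin M) (Fin M) ℝ)).PosSemidef ∧
      (lamU k • (1 : Matrix (Fin M) (Fin M) ℝ) - hessianMatrix (J k) w).PosSemidef) ∧
    ∀ m, ∃ k ∈ groupAgents group m, 0 < lamL k
  hessian_lipschitz : ∃ kappaH : ℝ, 0 ≤ kappaH ∧ ∀ W₁ W₂ : NetVec N M,
    ‖networkHessian J W₁ - networkHessian J W₂‖ ≤ kappaH * ‖W₁ - W₂‖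

section Stochastic

/-- The network gradient noise at iteration `i`: the field
`W ↦ col{ĝ_{k,i}(w_k) - ∇J_k(w_k)}`, where `gradHat i k ω w` is the stochastic approximation of
`∇J_k(w)` used at iteration `i`. -/
noncomputable def gradNoise {N M : ℕ} {Ω : Type*}
    (J : Fin N → EuclideanSpace ℝ (Fin M) → ℝ)
    (gradHat : ℕ → Fin N → Ω → EuclideanSpace ℝ (Fin M) → EuclideanSpace ℝ (Fin M))
    (i : ℕ) (ω : Ω) (W : NetVec N M) : NetVec N M :=
  WithLp.toLp 2 fun k => gradHat i k ω (W k) - gradient (J k) (W k)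

/-- The conditional covariance, given `ℱ i`, of the network gradient noise at the random point
`W`. Here `ℱ i` is the information available before iteration `i`. -/
noncomputable def noiseCov {N M : ℕ} {Ω : Type*} [mΩ : MeasurableSpace Ω] (P : Measure Ω)
    (ℱ : Filtration ℕ mΩ)
    (J : Fin N → EuclideanSpace ℝ (Fin M) → ℝ)
    (gradHat : ℕ → Fin N → Ω → EuclideanSpace ℝ (Fin M) → EuclideanSpace ℝ (Fin M))
    (i : ℕ) (W : Ω → NetVec N M) (ω : Ω) : NetMat N M :=
  Matrix.of fun x y =>
    (P[fun ω' => gradNoise J gradHat i ω' (W ω') x.1 x.2 * gradNoise J gradHat i ω' (W ω') y.1 y.2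
      | ℱ i]) ω

/-- The conditions on the gradient noise, with limiting covariance `Rs`. The first four hold for
every `W` that is known before iteration `i` and has a finite fourth moment; for such `W` the noise
has a finite fourth moment too, so that all the conditional expectations are genuine. -/
structure NoiseAssumption {N M : ℕ} {Ω : Type*} [mΩ : MeasurableSpace Ω] (P : Measure Ω)
    (ℱ : Filtration ℕ mΩ)
    (J : Fin N → EuclideanSpace ℝ (Fin M) → ℝ) (wo : NetVec N M)
    (gradHat : ℕ → Fin N → Ω → EuclideanSpace ℝ (Fin M) → EuclideanSpace ℝ (Fin M))
    (Rs : NetMat N M) : Prop where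
  measurable : ∀ (i : ℕ) (W : Ω → NetVec N M), StronglyMeasurable[ℱ i] W → MemLp W 4 P →
    StronglyMeasurable[ℱ (i + 1)] (fun ω => gradNoise J gradHat i ω (W ω)) ∧
    MemLp (fun ω => gradNoise J gradHat i ω (W ω)) 4 P
  martingale_difference : ∀ (i : ℕ) (W : Ω → NetVec N M),
    StronglyMeasurable[ℱ i] W → MemLp W 4 P →
    P[fun ω => gradNoise J gradHat i ω (W ω) | ℱ i] =ᵐ[P] 0
  fourth_moment : ∃ α σ : ℝ, 0 ≤ α ∧ 0 ≤ σ ∧ ∀ (i : ℕ) (W : Ω → NetVec N M),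
    StronglyMeasurable[ℱ i] W → MemLp W 4 P →
    P[fun ω => ‖gradNoise J gradHat i ω (W ω)‖ ^ 4 | ℱ i] ≤ᵐ[P]
      fun ω => α ^ 2 * ‖wo - W ω‖ ^ 4 + σ ^ 4
  covariance_lipschitz : ∃ κ γ : ℝ, 0 ≤ κ ∧ 0 < γ ∧ γ ≤ 4 ∧ ∀ (i : ℕ) (W : Ω → NetVec N M),
    StronglyMeasurable[ℱ i] W → MemLp W 4 P →
    ∀ᵐ ω ∂P, ‖noiseCov P ℱ J gradHat i (fun _ => wo) ω - noiseCov P ℱ J gradHat i W ω‖ ≤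
      κ * ‖wo - W ω‖ ^ γ
  covariance_limit : ∀ᵐ ω ∂P,
    Tendsto (fun i => noiseCov P ℱ J gradHat i (fun _ => wo) ω) atTop (𝓝 Rs)
  covariance_posDef : Rs.PosDef

/-- The adapt-then-combine diffusion recursion inside the groups, with step-sizes `μ k`.
`diffusion … i` is the network estimate available before iteration `i`; the initial one is zero. -/
noncomputable def diffusion {N M G : ℕ} {Ω : Type*}
    (nbr : Fin N → Finset (Fin N)) (group : Fin N → Fin G) (A : Matrix (Fin N) (Fin N) ℝ)
    (gradHat : ℕ → Fin N → Ω → EuclideanSpace ℝ (Fin M) → EuclideanSpace ℝ (Fin M))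
    (μ : Fin N → ℝ) : ℕ → Ω → NetVec N M
  | 0, _ => 0
  | i + 1, ω => WithLp.toLp 2 fun k =>
      ∑ l ∈ nbr k ∩ groupAgents group (group k),
        A l k • (diffusion nbr group A gradHat μ i ω l
          - μ l • gradHat i l ω (diffusion nbr group A gradHat μ i ω l))

end Stochastic

/-- The largest step-size. -/
noncomputable def stepMax {N : ℕ} (μ : Fin N → ℝ) : ℝ := ⨆ k, μ k

/-- The normalized mean-square deviation `limsup_i μ_max⁻¹ E‖wo - W_i‖²`, as an extended
nonnegative real. -/
noncomputable def normalizedMSD {N M G : ℕ} {Ω : Type*} [MeasurableSpace Ω] (P : Measure Ω)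
    (nbr : Fin N → Finset (Fin N)) (group : Fin N → Fin G) (A : Matrix (Fin N) (Fin N) ℝ)
    (gradHat : ℕ → Fin N → Ω → EuclideanSpace ℝ (Fin M) → EuclideanSpace ℝ (Fin M))
    (wo : NetVec N M) (μ : Fin N → ℝ) : ℝ≥0∞ :=
  limsup (fun i => (ENNReal.ofReal (stepMax μ))⁻¹ *
    ∫⁻ ω, ‖wo - diffusion nbr group A gradHat μ i ω‖ₑ ^ 2 ∂P) atTop

/-- `∑_m N_m/(2 μ_max) Tr[(∑_{k ∈ G_m} p_k μ_k H_k)⁻¹ (∑_{k ∈ G_m} p_k² μ_k² R_k)]`, with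
`H_k = ∇²J_k(wo k)` and `R_k` the `k`-th diagonal block of `Rs`. -/
noncomputable def groupMSDSum {N M G : ℕ} (group : Fin N → Fin G)
    (J : Fin N → EuclideanSpace ℝ (Fin M) → ℝ) (wo : NetVec N M) (Rs : NetMat N M)
    (p μ : Fin N → ℝ) : ℝ :=
  ∑ m : Fin G, ((groupAgents group m).card : ℝ) / (2 * stepMax μ) *
    Matrix.trace
      ((∑ k ∈ groupAgents group m, (p k * μ k) • hessianMatrix (J k) (wo k))⁻¹ *
        ∑ k ∈ groupAgents group m, (p k ^ 2 * μ k ^ 2) • Rs.block k k)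

/-- The same sum with the cross-covariance blocks of agents of the same group retained:
`∑_m N_m/(2 μ_max) Tr[(∑_{k ∈ G_m} p_k μ_k H_k)⁻¹ (∑_{k, l ∈ G_m} p_k p_l μ_k μ_l R_{kl})]`. -/
noncomputable def groupMSDSumCross {N M G : ℕ} (group : Fin N → Fin G)
    (J : Fin N → EuclideanSpace ℝ (Fin M) → ℝ) (wo : NetVec N M) (Rs : NetMat N M)
    (p μ : Fin N → ℝ) : ℝ :=
  ∑ m : Fin G, ((groupAgents group m).card : ℝ) / (2 * stepMax μ) *
    Matrix.trace
      ((∑ k ∈ groupAgents group m, (p k * μ k) • hessianMatrix (J k) (wo k))⁻¹ *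
        ∑ k ∈ groupAgents group m, ∑ l ∈ groupAgents group m,
          (p k * p l * (μ k * μ l)) • Rs.block k l)


/-! The error `z = wo - W` of the network estimate obeys `z⁺ = L (z + t (g z + s))`, where `L`
averages within the groups, `t` is the common scale of the step-sizes, `g` is the negative gradient
weighted by the step-sizes and `s` is a martingale difference. In the norm weighted by the Perron
vectors `L` does not expand while the drift contracts by a factor `1 - c t`, whence
`E‖z‖⁴ = O(t²)`. The deviations from the group means contract at a rate independent of `t`, so they
are `O(t)` in `L²` and negligible against `‖z‖ ~ √t`.

What remains is the motion of the group means. Let `ℓ` be the component of the mean of group `m`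
along an eigenvector `u` of `∑_{k ∈ G_m} p_k μ_k H_k`, with eigenvalue `λ`. By the Perron equation
`ℓ` is invariant under `L`, and `ℓ (g z) = -λ ℓ z` up to the group deviation and a quadratic error,
so the second moment of `ℓ z` is multiplied by `1 - 2λt` and increased by `t² v` at every
iteration, where `v` is the limiting noise variance along `ℓ`; balancing the two gives
`E (ℓ z)² / t → v / (2λ)`. Summing over an orthonormal eigenbasis and over the agents turns
`∑ v / (2λ)` into the trace formula. -/

/-! ### Iterated limits and contractions -/

section IteratedLimit

variable {α β : Type*} {l : Filter α}

theorem eventually_le_of_linear_recursion {u : ℕ → ℝ} {a b c : ℝ} (ha : 0 < a) (ha1 : a ≤ 1)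
    (h : ∀ᶠ i in atTop, u (i + 1) ≤ (1 - a) * u i + b) (hc : b / a < c) :
    ∀ᶠ i in atTop, u i ≤ c := by
  obtain ⟨n, hn⟩ := eventually_atTop.1 h
  have excess_le : ∀ j, u (n + j) ≤ b / a + (1 - a) ^ j * (u n - b / a) := by
    intro j
    induction j with
    | zero => simp
    | succ j ih =>
      calc u (n + j + 1) ≤ (1 - a) * u (n + j) + b := hn _ (Nat.le_add_right _ _)
        _ ≤ (1 - a) * (b / a + (1 - a) ^ j * (u n - b / a)) + b := by
          gcongr
        _ = b / a + (1 - a) ^ (j + 1) * (u n - b / a) := by field_simp; ring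
  have excess_tendsto : Tendsto (fun j : ℕ => b / a + (1 - a) ^ j * (u n - b / a)) atTop
      (𝓝 (b / a)) := by
    simpa using ((tendsto_pow_atTop_nhds_zero_of_lt_one (sub_nonneg.2 ha1)
      (by linarith : 1 - a < 1)).mul_const (u n - b / a)).const_add (b / a)
  obtain ⟨k, hk⟩ := eventually_atTop.1 (excess_tendsto.eventually (gt_mem_nhds hc))
  refine eventually_atTop.2 ⟨n + k, fun i hi => ?_⟩
  obtain ⟨j, rfl⟩ := Nat.exists_eq_add_of_le (le_trans (Nat.le_add_right n k) hi)
  exact (excess_le j).trans (hk j (by omega)).le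

section Contraction

variable {E : Type*} [NormedAddCommGroup E] {u : α × ℕ → E} {r : α × ℕ → ℝ} {a c : α → ℝ}

theorem eventually_norm_le_of_contraction {K K' : ℝ} (hK : K < K')
    (ha : ∀ᶠ t in l, 0 < a t ∧ a t ≤ 1) (hc : ∀ᶠ t in l, 0 < c t)
    (hu : ∀ᶠ x in l.curry atTop, ‖u (x.1, x.2 + 1)‖ ≤ (1 - a x.1) * ‖u x‖ + r x)
    (hr : ∀ᶠ x in l.curry atTop, r x ≤ K * (a x.1 * c x.1)) :
    ∀ᶠ x in l.curry atTop, ‖u x‖ ≤ K' * c x.1 := by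
  refine eventually_curry_iff.2 ?_
  filter_upwards [ha, hc, eventually_curry_iff.1 (hu.and hr)] with t ⟨ht, ht1⟩ hct h
  refine eventually_le_of_linear_recursion (u := fun i => ‖u (t, i)‖) (b := K * (a t * c t)) ht ht1
    (h.mono fun i hi => hi.1.trans (by gcongr; exact hi.2)) ?_
  rw [mul_div_assoc, mul_div_cancel_left₀ _ ht.ne']
  gcongr

theorem isBigO_of_contraction (ha : ∀ᶠ t in l, 0 < a t ∧ a t ≤ 1) (hc : ∀ᶠ t in l, 0 < c t)
    (hu : ∀ᶠ x in l.curry atTop, ‖u (x.1, x.2 + 1)‖ ≤ (1 - a x.1) * ‖u x‖ + r x)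
    (hr : r =O[l.curry atTop] fun x => a x.1 * c x.1) :
    u =O[l.curry atTop] fun x => c x.1 := by
  obtain ⟨K, hK⟩ := hr.bound
  have pos : ∀ᶠ x : α × ℕ in l.curry atTop, (0 < a x.1 ∧ a x.1 ≤ 1) ∧ 0 < c x.1 :=
    (ha.and hc).mono fun t ht => Eventually.of_forall fun _ => ht
  refine Asymptotics.IsBigO.of_bound (K + 1) ?_
  filter_upwards [pos, eventually_norm_le_of_contraction (lt_add_one K) ha hc hu
    ((hK.and pos).mono fun x hx => (le_abs_self _).trans
      (hx.1.trans_eq (by rw [Real.norm_of_nonneg (mul_pos hx.2.1.1 hx.2.2).le])))] with x hx h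
  rwa [Real.norm_of_nonneg hx.2.le]

theorem isLittleO_of_contraction (ha : ∀ᶠ t in l, 0 < a t ∧ a t ≤ 1) (hc : ∀ᶠ t in l, 0 < c t)
    (hu : ∀ᶠ x in l.curry atTop, ‖u (x.1, x.2 + 1)‖ ≤ (1 - a x.1) * ‖u x‖ + r x)
    (hr : r =o[l.curry atTop] fun x => a x.1 * c x.1) :
    u =o[l.curry atTop] fun x => c x.1 := by
  have pos : ∀ᶠ x : α × ℕ in l.curry atTop, (0 < a x.1 ∧ a x.1 ≤ 1) ∧ 0 < c x.1 :=
    (ha.and hc).mono fun t ht => Eventually.of_forall fun _ => ht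
  refine Asymptotics.IsLittleO.of_bound fun ε hε => ?_
  filter_upwards [pos, eventually_norm_le_of_contraction (half_lt_self hε) ha hc hu
    (((hr.bound (half_pos hε)).and pos).mono fun x hx => (le_abs_self _).trans
      (hx.1.trans_eq (by rw [Real.norm_of_nonneg (mul_pos hx.2.1.1 hx.2.2).le])))] with x hx h
  rwa [Real.norm_of_nonneg hx.2.le]

end Contraction

theorem tendsto_limsup_of_tendsto_curry {γ : Type*} [CompleteLinearOrder γ] [DenselyOrdered γ]
    [TopologicalSpace γ] [OrderTopology γ] {l' : Filter β} [l'.NeBot] {F : α × β → γ} {c : γ}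
    (h : Tendsto F (l.curry l') (𝓝 c)) :
    Tendsto (fun x => limsup (fun y => F (x, y)) l') l (𝓝 c) := by
  refine tendsto_order.2 ⟨fun b hb => ?_, fun b hb => ?_⟩
  · obtain ⟨b', hbb', hb'⟩ := exists_between hb
    filter_upwards [eventually_curry_iff.1 (h.eventually (lt_mem_nhds hb'))] with x hx
    exact hbb'.trans_le (le_limsup_of_frequently_le (hx.mono fun _ => le_of_lt).frequently)
  · obtain ⟨b', hb', hbb'⟩ := exists_between hb
    filter_upwards [eventually_curry_iff.1 (h.eventually (gt_mem_nhds hb'))] with x hx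
    exact (limsup_le_of_le (h := hx.mono fun _ => le_of_lt)).trans_lt hbb'

/-- The steady-state regime of a process indexed by pairs (step-size, iteration): the iteration
tends to infinity first, then the step-size tends to zero from above. -/
def steadyState : Filter (ℝ × ℕ) := (𝓝[>] 0).curry atTop

theorem tendsto_fst_steadyState : Tendsto Prod.fst steadyState (𝓝[>] (0 : ℝ)) :=
  tendsto_fst.mono_left curry_le_prod

theorem tendsto_snd_steadyState : Tendsto Prod.snd steadyState atTop :=
  tendsto_snd.mono_left curry_le_prod

theorem tendsto_zero_of_sq_isBigO_fst {f : ℝ × ℕ → ℝ}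
    (hf : (fun x => f x ^ 2) =O[steadyState] fun x => x.1) : Tendsto f steadyState (𝓝 0) := by
  have fst_isLittleO : (fun x : ℝ × ℕ => x.1) =o[steadyState] fun _ => (1 : ℝ) :=
    (Asymptotics.isLittleO_one_iff ℝ).2
      (tendsto_fst_steadyState.mono_right nhdsWithin_le_nhds)
  exact (Asymptotics.isLittleO_one_iff ℝ).1 <| .of_pow (n := 2)
    ((hf.trans_isLittleO fst_isLittleO).congr_right fun _ => by simp) two_ne_zero

theorem eventually_pos_steadyState : ∀ᶠ x in steadyState, 0 < x.1 :=
  tendsto_fst_steadyState.eventually self_mem_nhdsWithin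

theorem eventually_pos_and_mul_le_one {a : ℝ} (ha : 0 < a) :
    ∀ᶠ t : ℝ in 𝓝[>] 0, 0 < a * t ∧ a * t ≤ 1 := by
  filter_upwards [Ioo_mem_nhdsGT (inv_pos.2 ha)] with t ht
  exact ⟨mul_pos ha ht.1, by simpa [ha.ne'] using mul_le_mul_of_nonneg_left ht.2.le ha.le⟩

end IteratedLimit

/-! ### Moments -/

theorem norm_add_pow_four_le {E : Type*} [NormedAddCommGroup E] [InnerProductSpace ℝ E] (a b : E) :
    ‖a + b‖ ^ 4 ≤
      ‖a‖ ^ 4 + 4 * (‖a‖ ^ 2 * inner ℝ a b) + 8 * (‖a‖ ^ 2 * ‖b‖ ^ 2) + 3 * ‖b‖ ^ 4 := by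
  have inner_le : |inner ℝ a b| ≤ ‖a‖ * ‖b‖ := abs_real_inner_le_norm a b
  have inner_sq_le : (inner ℝ a b) ^ 2 ≤ ‖a‖ ^ 2 * ‖b‖ ^ 2 := by
    rw [← mul_pow, ← sq_abs]; gcongr
  have inner_mul_sq_le : inner ℝ a b * ‖b‖ ^ 2 ≤ (‖a‖ ^ 2 * ‖b‖ ^ 2 + ‖b‖ ^ 4) / 2 := by
    calc inner ℝ a b * ‖b‖ ^ 2 ≤ (‖a‖ * ‖b‖) * ‖b‖ ^ 2 := by
          gcongr; exact (le_abs_self _).trans inner_le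
      _ ≤ _ := by nlinarith only [sq_nonneg (‖a‖ * ‖b‖ - ‖b‖ ^ 2)]
  calc ‖a + b‖ ^ 4 = (‖a + b‖ ^ 2) ^ 2 := by ring
    _ = (‖a‖ ^ 2 + 2 * inner ℝ a b + ‖b‖ ^ 2) ^ 2 := by rw [norm_add_sq_real]
    _ ≤ _ := by nlinarith only [inner_sq_le, inner_mul_sq_le]

section Moments

variable {Ω : Type*} {mΩ : MeasurableSpace Ω} {P : Measure Ω}
  {E F : Type*} [NormedAddCommGroup E] [NormedAddCommGroup F]

theorem lpNorm_natCast_pow {n : ℕ} (hn : n ≠ 0) {f : Ω → E} (hf : AEStronglyMeasurable f P) :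
    lpNorm f n P ^ n = ∫ ω, ‖f ω‖ ^ n ∂P := by
  rw [lpNorm_eq_integral_norm_rpow_toReal (by simpa) (by simp) hf]
  simp only [ENNReal.toReal_natCast, Real.rpow_natCast]
  exact Real.rpow_inv_natCast_pow (integral_nonneg fun _ => by positivity) hn

theorem lpNorm_two_sq {f : Ω → E} (hf : AEStronglyMeasurable f P) :
    lpNorm f 2 P ^ 2 = ∫ ω, ‖f ω‖ ^ 2 ∂P := by
  simpa using lpNorm_natCast_pow two_ne_zero hf

theorem lpNorm_four_pow {f : Ω → E} (hf : AEStronglyMeasurable f P) :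
    lpNorm f 4 P ^ 4 = ∫ ω, ‖f ω‖ ^ 4 ∂P := by
  simpa using lpNorm_natCast_pow four_ne_zero hf

theorem lpNorm_norm_sq {f : Ω → E} (hf : AEStronglyMeasurable f P) :
    lpNorm (fun ω => ‖f ω‖ ^ 2) 2 P = lpNorm f 4 P ^ 2 := by
  refine (pow_left_inj₀ lpNorm_nonneg (by positivity) two_ne_zero).1 ?_
  rw [lpNorm_two_sq (f := fun ω => ‖f ω‖ ^ 2) (hf.norm.pow 2), ← pow_mul, lpNorm_four_pow hf]
  simp only [norm_pow, norm_norm, ← pow_mul]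

theorem lpNorm_le_mul_lpNorm {q : ℝ≥0∞} {f : Ω → E} {g : Ω → F} (hg : MemLp g q P) {C : ℝ}
    (hC : 0 ≤ C) (h : ∀ ω, ‖f ω‖ ≤ C * ‖g ω‖) : lpNorm f q P ≤ C * lpNorm g q P := by
  calc lpNorm f q P ≤ lpNorm (C • fun ω => ‖g ω‖) q P := lpNorm_mono_real (hg.norm.const_smul C) h
    _ = C * lpNorm g q P := by
      rw [lpNorm_const_smul, lpNorm_norm hg.1, coe_nnnorm, Real.norm_of_nonneg hC]

theorem integral_norm_pow_le_mul {n : ℕ} {f : Ω → E} {g : Ω → F} {C : ℝ}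
    (hg : Integrable (fun ω => ‖g ω‖ ^ n) P) (h : ∀ ω, ‖f ω‖ ≤ C * ‖g ω‖) :
    ∫ ω, ‖f ω‖ ^ n ∂P ≤ C ^ n * ∫ ω, ‖g ω‖ ^ n ∂P := by
  rw [← integral_const_mul]
  refine integral_mono_of_nonneg (ae_of_all _ fun ω => by positivity) (hg.const_mul _)
    (ae_of_all _ fun ω => ?_)
  simpa only [mul_pow] using pow_le_pow_left₀ (norm_nonneg _) (h ω) n

theorem memLp_norm_sq {f : Ω → E} (hf : MemLp f 4 P) : MemLp (fun ω => ‖f ω‖ ^ 2) 2 P := by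
  refine (memLp_two_iff_integrable_sq (hf.1.norm.pow 2)).2 ?_
  simpa [← pow_mul] using hf.integrable_norm_pow (p := 4) four_ne_zero

theorem lpNorm_le_lpNorm_of_exponent_le [IsProbabilityMeasure P] {q q' : ℝ≥0∞} (hq : q ≤ q')
    {f : Ω → E} (hf : MemLp f q' P) : lpNorm f q P ≤ lpNorm f q' P := by
  rw [← toReal_eLpNorm hf.1, ← toReal_eLpNorm hf.1]
  exact ENNReal.toReal_mono hf.2.ne (eLpNorm_le_eLpNorm_of_exponent_le hq hf.1)

variable [InnerProductSpace ℝ E]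

theorem integrable_inner_of_memLp_two {f g : Ω → E} (hf : MemLp f 2 P) (hg : MemLp g 2 P) :
    Integrable (fun ω => inner ℝ (f ω) (g ω)) P :=
  (hf.norm.integrable_mul hg.norm).mono' (hf.1.inner hg.1)
    (ae_of_all _ fun _ => norm_inner_le_norm _ _)

theorem abs_integral_inner_le {f g : Ω → E} (hf : MemLp f 2 P) (hg : MemLp g 2 P) :
    |∫ ω, inner ℝ (f ω) (g ω) ∂P| ≤ lpNorm f 2 P * lpNorm g 2 P := by
  have h := abs_real_inner_le_norm (hf.toLp f) (hg.toLp g)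
  rw [L2.inner_def, Lp.norm_toLp, Lp.norm_toLp, toReal_eLpNorm hf.1, toReal_eLpNorm hg.1] at h
  refine (congrArg abs (integral_congr_ae ?_)).trans_le h
  filter_upwards [hf.coeFn_toLp, hg.coeFn_toLp] with ω hfω hgω
  rw [hfω, hgω]

section CondExp

variable {m : MeasurableSpace Ω} [IsFiniteMeasure P] [CompleteSpace E] {X Y : Ω → E}

theorem integral_inner_eq_zero_of_condExp_eq_zero (hm : m ≤ mΩ) (hX : StronglyMeasurable[m] X)
    (hXY : Integrable (fun ω => inner ℝ (X ω) (Y ω)) P) (hY : Integrable Y P)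
    (h0 : P[Y | m] =ᵐ[P] 0) : ∫ ω, inner ℝ (X ω) (Y ω) ∂P = 0 := by
  rw [← integral_condExp hm]
  refine integral_eq_zero_of_ae ?_
  filter_upwards [condExp_bilin_of_stronglyMeasurable_left (innerSL ℝ (E := E)) hX hXY hY, h0]
    with ω pull_out hω
  exact pull_out.trans (by simp [hω])

theorem integral_norm_add_sq_of_condExp_eq_zero (hm : m ≤ mΩ) (hX : StronglyMeasurable[m] X)
    (hX2 : MemLp X 2 P) (hY2 : MemLp Y 2 P) (h0 : P[Y | m] =ᵐ[P] 0) :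
    ∫ ω, ‖X ω + Y ω‖ ^ 2 ∂P = ∫ ω, ‖X ω‖ ^ 2 ∂P + ∫ ω, ‖Y ω‖ ^ 2 ∂P := by
  have hX_sq : Integrable (fun ω => ‖X ω‖ ^ 2) P := hX2.integrable_norm_pow two_ne_zero
  have hY_sq : Integrable (fun ω => ‖Y ω‖ ^ 2) P := hY2.integrable_norm_pow two_ne_zero
  have hXY := integrable_inner_of_memLp_two hX2 hY2
  have hX_sq_add : Integrable (fun ω => ‖X ω‖ ^ 2 + 2 * inner ℝ (X ω) (Y ω)) P :=
    hX_sq.add (hXY.const_mul 2)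
  simp_rw [norm_add_sq_real]
  rw [integral_add hX_sq_add hY_sq, integral_add hX_sq (hXY.const_mul 2),
    integral_const_mul, integral_inner_eq_zero_of_condExp_eq_zero hm hX hXY
      (hY2.integrable one_le_two) h0, mul_zero, add_zero]

theorem integral_norm_add_pow_four_le_of_condExp_eq_zero (hm : m ≤ mΩ)
    (hX : StronglyMeasurable[m] X) (hX4 : MemLp X 4 P) (hY4 : MemLp Y 4 P)
    (h0 : P[Y | m] =ᵐ[P] 0) {θ : ℝ} (hθ : 0 < θ) :
    ∫ ω, ‖X ω + Y ω‖ ^ 4 ∂P ≤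
      (1 + θ) * ∫ ω, ‖X ω‖ ^ 4 ∂P + (16 / θ + 3) * ∫ ω, ‖Y ω‖ ^ 4 ∂P := by
  have hX_pow : Integrable (fun ω => ‖X ω‖ ^ 4) P := hX4.integrable_norm_pow four_ne_zero
  have hY_pow : Integrable (fun ω => ‖Y ω‖ ^ 4) P := hY4.integrable_norm_pow four_ne_zero
  have cross_integrable : Integrable (fun ω => inner ℝ (‖X ω‖ ^ 2 • X ω) (Y ω)) P := by
    refine ((hX_pow.add ((memLp_norm_sq hX4).integrable_mul (memLp_norm_sq hY4))).mono'
      (((hX4.1.norm.pow 2).smul hX4.1).inner hY4.1) (ae_of_all _ fun ω => ?_))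
    refine (norm_inner_le_norm _ _).trans ?_
    simp only [Pi.add_apply, Pi.mul_apply, norm_smul, norm_pow, norm_norm]
    nlinarith only [sq_nonneg (‖X ω‖ * (‖X ω‖ - ‖Y ω‖)), sq_nonneg (‖X ω‖ * ‖X ω‖),
      sq_nonneg (‖X ω‖ * ‖Y ω‖)]
  have cross_eq_zero : ∫ ω, inner ℝ (‖X ω‖ ^ 2 • X ω) (Y ω) ∂P = 0 :=
    integral_inner_eq_zero_of_condExp_eq_zero hm ((hX.norm.pow 2).smul hX) cross_integrable
      (hY4.integrable (by norm_num)) h0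
  have pointwise (ω : Ω) : ‖X ω + Y ω‖ ^ 4 ≤ (1 + θ) * ‖X ω‖ ^ 4 +
      4 * inner ℝ (‖X ω‖ ^ 2 • X ω) (Y ω) + (16 / θ + 3) * ‖Y ω‖ ^ 4 := by
    have young : 8 * (‖X ω‖ ^ 2 * ‖Y ω‖ ^ 2) ≤ θ * ‖X ω‖ ^ 4 + 16 / θ * ‖Y ω‖ ^ 4 := by
      have : 0 ≤ (θ * ‖X ω‖ ^ 2 - 4 * ‖Y ω‖ ^ 2) ^ 2 / θ := by positivity
      have expand : (θ * ‖X ω‖ ^ 2 - 4 * ‖Y ω‖ ^ 2) ^ 2 / θ =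
          θ * ‖X ω‖ ^ 4 + 16 / θ * ‖Y ω‖ ^ 4 - 8 * (‖X ω‖ ^ 2 * ‖Y ω‖ ^ 2) := by
        field_simp; ring
      linarith
    simp only [real_inner_smul_left]
    linarith [norm_add_pow_four_le (X ω) (Y ω)]
  calc ∫ ω, ‖X ω + Y ω‖ ^ 4 ∂P ≤ _ := integral_mono
        ((hX4.add hY4).integrable_norm_pow four_ne_zero)
        (((hX_pow.const_mul _).add (cross_integrable.const_mul _)).add (hY_pow.const_mul _))
        pointwise
    _ = _ := by
      rw [integral_add' ((hX_pow.const_mul _).add (cross_integrable.const_mul _))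
        (hY_pow.const_mul _), integral_add' (hX_pow.const_mul _) (cross_integrable.const_mul _),
        integral_const_mul, integral_const_mul, integral_const_mul, cross_eq_zero, mul_zero,
        add_zero]

end CondExp

end Moments

/-! ### Stochastic recursions with small steps -/

section NoisyRecursion

variable {Ω : Type*} [mΩ : MeasurableSpace Ω] {P : Measure Ω} {ℱ : Filtration ℕ mΩ}
  {V W : Type*} [NormedAddCommGroup V] [NormedSpace ℝ V] [NormedAddCommGroup W]

/-- The random recursion `z ↦ L (z + t (g z + s))`, where the noise `s` is a martingale difference
whose fourth moment is controlled by that of the state `z`. The processes are indexed by pairs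
`(t, i)` of a step-size and an iteration. -/
structure IsNoisyRecursion (P : Measure Ω) (ℱ : Filtration ℕ mΩ) (L : V →L[ℝ] V) (g : V → V)
    (z s : ℝ × ℕ → Ω → V) : Prop where
  drift_continuous : Continuous g
  exists_norm_drift_le : ∃ C, 0 ≤ C ∧ ∀ x, ‖g x‖ ≤ C * ‖x‖
  step : ∀ t i ω, z (t, i + 1) ω = L (z (t, i) ω + t • (g (z (t, i) ω) + s (t, i) ω))
  stronglyMeasurable : ∀ x : ℝ × ℕ, StronglyMeasurable[ℱ x.2] (z x)
  memLp : ∀ x, MemLp (z x) 4 P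
  noise_memLp : ∀ x, MemLp (s x) 4 P
  noise_condExp : ∀ x : ℝ × ℕ, P[s x | ℱ x.2] =ᵐ[P] 0
  exists_noise_fourth_le : ∃ K, 0 ≤ K ∧ ∀ x,
    ∫ ω, ‖s x ω‖ ^ 4 ∂P ≤ K * (∫ ω, ‖z x ω‖ ^ 4 ∂P + 1)

theorem condExp_clm_smul_eq_zero [CompleteSpace V] [NormedSpace ℝ W] [CompleteSpace W]
    {m : MeasurableSpace Ω}
    (T : V →L[ℝ] W) (t : ℝ) {f : Ω → V} (hf : Integrable f P) (h : P[f | m] =ᵐ[P] 0) :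
    P[fun ω => t • T (f ω) | m] =ᵐ[P] 0 := by
  filter_upwards [(t • T).comp_condExp_comm hf (m := m), h] with ω hω h0
  exact hω.symm.trans (by simp [h0])

namespace IsNoisyRecursion

variable {L : V →L[ℝ] V} {g : V → V} {z s : ℝ × ℕ → Ω → V}

theorem memLp_drift (h : IsNoisyRecursion P ℱ L g z s) (x : ℝ × ℕ) :
    MemLp (fun ω => g (z x ω)) 4 P := by
  obtain ⟨C, -, hC⟩ := h.exists_norm_drift_le
  exact (h.memLp x).of_le_mul (h.drift_continuous.comp_aestronglyMeasurable (h.memLp x).1)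
    (ae_of_all _ fun ω => hC _)

variable [IsProbabilityMeasure P]

theorem lpNorm_two_le (h : IsNoisyRecursion P ℱ L g z s) (x : ℝ × ℕ) :
    lpNorm (z x) 2 P ≤ lpNorm (z x) 4 P :=
  lpNorm_le_lpNorm_of_exponent_le (by norm_num) (h.memLp x)

theorem memLp_two (h : IsNoisyRecursion P ℱ L g z s) (x : ℝ × ℕ) : MemLp (z x) 2 P :=
  (h.memLp x).mono_exponent (by norm_num)

theorem memLp_drift_two (h : IsNoisyRecursion P ℱ L g z s) (x : ℝ × ℕ) :
    MemLp (fun ω => g (z x ω)) 2 P :=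
  (h.memLp_drift x).mono_exponent (by norm_num)

theorem noise_memLp_two (h : IsNoisyRecursion P ℱ L g z s) (x : ℝ × ℕ) : MemLp (s x) 2 P :=
  (h.noise_memLp x).mono_exponent (by norm_num)

section FourthMoment

variable [InnerProductSpace ℝ W] [CompleteSpace W]

theorem integral_norm_pow_four_succ_le [CompleteSpace V] (h : IsNoisyRecursion P ℱ L g z s)
    (S : V →L[ℝ] W) {t ρ θ : ℝ} (hθ : 0 < θ)
    (hS : ∀ x, ‖S (L (x + t • g x))‖ ≤ ρ * ‖S x‖) (i : ℕ) :
    ∫ ω, ‖S (z (t, i + 1) ω)‖ ^ 4 ∂P ≤ (1 + θ) * (ρ ^ 4 * ∫ ω, ‖S (z (t, i) ω)‖ ^ 4 ∂P) +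
      (16 / θ + 3) * ((|t| * ‖S ∘L L‖) ^ 4 * ∫ ω, ‖s (t, i) ω‖ ^ 4 ∂P) := by
  have hz := h.memLp (t, i)
  have hs := h.noise_memLp (t, i)
  have drift_measurable : StronglyMeasurable[ℱ i] fun ω =>
      S (L (z (t, i) ω + t • g (z (t, i) ω))) := by
    have := h.drift_continuous
    exact Continuous.comp_stronglyMeasurable (g := fun x => S (L (x + t • g x))) (by fun_prop)
      (h.stronglyMeasurable (t, i))
  have drift_memLp : MemLp (fun ω => S (L (z (t, i) ω + t • g (z (t, i) ω)))) 4 P :=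
    (S ∘L L).comp_memLp' (hz.add ((h.memLp_drift _).const_smul t))
  have noise_memLp : MemLp (fun ω => t • (S ∘L L) (s (t, i) ω)) 4 P :=
    ((S ∘L L).comp_memLp' hs).const_smul t
  have drift_le : ∫ ω, ‖S (L (z (t, i) ω + t • g (z (t, i) ω)))‖ ^ 4 ∂P ≤
      ρ ^ 4 * ∫ ω, ‖S (z (t, i) ω)‖ ^ 4 ∂P :=
    integral_norm_pow_le_mul ((S.comp_memLp' hz).integrable_norm_pow four_ne_zero) fun ω => hS _
  have noise_le : ∫ ω, ‖t • (S ∘L L) (s (t, i) ω)‖ ^ 4 ∂P ≤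
      (|t| * ‖S ∘L L‖) ^ 4 * ∫ ω, ‖s (t, i) ω‖ ^ 4 ∂P := by
    refine integral_norm_pow_le_mul (hs.integrable_norm_pow four_ne_zero) fun ω => ?_
    rw [norm_smul, mul_assoc, Real.norm_eq_abs]
    gcongr
    exact (S ∘L L).le_opNorm _
  calc ∫ ω, ‖S (z (t, i + 1) ω)‖ ^ 4 ∂P
      = ∫ ω, ‖S (L (z (t, i) ω + t • g (z (t, i) ω))) + t • (S ∘L L) (s (t, i) ω)‖ ^ 4 ∂P := by
        simp only [h.step, smul_add, map_add, map_smul, ContinuousLinearMap.comp_apply, add_assoc]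
    _ ≤ _ := integral_norm_add_pow_four_le_of_condExp_eq_zero (ℱ.le i) drift_measurable
        drift_memLp noise_memLp (condExp_clm_smul_eq_zero _ t
          (hs.integrable (by norm_num)) (h.noise_condExp (t, i))) hθ
    _ ≤ _ := by gcongr

theorem exists_integral_norm_pow_four_succ_le [CompleteSpace V]
    (h : IsNoisyRecursion P ℱ L g z s) {S : V →L[ℝ] W} {β c : ℝ} (hc : 0 < c)
    (hβ : ∀ x, ‖x‖ ≤ β * ‖S x‖)
    (hS : ∀ᶠ t in 𝓝[>] (0 : ℝ), ∀ x, ‖S (L (x + t • g x))‖ ≤ (1 - c * t) * ‖S x‖) :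
    ∃ K, ∀ᶠ t in 𝓝[>] (0 : ℝ), ∀ i, ∫ ω, ‖S (z (t, i + 1) ω)‖ ^ 4 ∂P ≤
      (1 - c * t) * ∫ ω, ‖S (z (t, i) ω)‖ ^ 4 ∂P +
        K * t ^ 3 * (∫ ω, ‖S (z (t, i) ω)‖ ^ 4 ∂P + 1) := by
  obtain ⟨K, hK, hnoise⟩ := h.exists_noise_fourth_le
  refine ⟨(16 / c + 3) * ‖S ∘L L‖ ^ 4 * (K * (β ^ 4 + 1)), ?_⟩
  filter_upwards [hS, eventually_pos_and_mul_le_one hc, eventually_pos_and_mul_le_one one_pos]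
    with t ht ⟨hct, hct1⟩ ⟨ht0, ht1⟩ i
  rw [one_mul] at ht0 ht1
  set u := ∫ ω, ‖S (z (t, i) ω)‖ ^ 4 ∂P
  have : 0 ≤ u := integral_nonneg fun ω => by positivity
  have state_le : ∫ ω, ‖z (t, i) ω‖ ^ 4 ∂P ≤ β ^ 4 * u :=
    integral_norm_pow_le_mul
      ((S.comp_memLp' (h.memLp (t, i))).integrable_norm_pow four_ne_zero) fun ω => hβ _
  have noise_le : ∫ ω, ‖s (t, i) ω‖ ^ 4 ∂P ≤ K * (β ^ 4 + 1) * (u + 1) := by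
    rw [mul_assoc]
    refine (hnoise (t, i)).trans (mul_le_mul_of_nonneg_left ?_ hK)
    calc _ ≤ β ^ 4 * u + 1 := by gcongr
      _ ≤ β ^ 4 * u + 1 + (β ^ 4 + u) := le_add_of_nonneg_right (by positivity)
      _ = (β ^ 4 + 1) * (u + 1) := by ring
  have contraction_le : (1 + c * t) * (1 - c * t) ^ 4 ≤ 1 - c * t := by
    have : (1 - c * t) ^ 3 ≤ 1 - c * t := pow_le_of_le_one (by linarith) (by linarith) three_ne_zero
    calc _ = (1 - (c * t) ^ 2) * (1 - c * t) ^ 3 := by ring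
      _ ≤ 1 * (1 - c * t) ^ 3 := by gcongr; nlinarith
      _ ≤ 1 - c * t := by rwa [one_mul]
  have coeff_le : (16 / (c * t) + 3) * t ^ 4 ≤ (16 / c + 3) * t ^ 3 := by
    calc (16 / (c * t) + 3) * t ^ 4 = (16 / c + 3 * t) * t ^ 3 := by field_simp
      _ ≤ (16 / c + 3) * t ^ 3 := by gcongr; linarith
  have step := h.integral_norm_pow_four_succ_le S hct ht i
  calc _ ≤ _ := step
    _ = (1 + c * t) * (1 - c * t) ^ 4 * u + (16 / (c * t) + 3) * t ^ 4 *
        (‖S ∘L L‖ ^ 4 * ∫ ω, ‖s (t, i) ω‖ ^ 4 ∂P) := by rw [abs_of_pos ht0]; ring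
    _ ≤ (1 - c * t) * u + (16 / c + 3) * t ^ 3 *
        (‖S ∘L L‖ ^ 4 * (K * (β ^ 4 + 1) * (u + 1))) := by gcongr
    _ = _ := by ring

theorem isBigO_lpNorm_four_sq [CompleteSpace V] (h : IsNoisyRecursion P ℱ L g z s)
    {S : V →L[ℝ] W} {β c : ℝ} (hc : 0 < c) (hβ : ∀ x, ‖x‖ ≤ β * ‖S x‖)
    (hS : ∀ᶠ t in 𝓝[>] (0 : ℝ), ∀ x, ‖S (L (x + t • g x))‖ ≤ (1 - c * t) * ‖S x‖) :
    (fun x => lpNorm (z x) 4 P ^ 2) =O[steadyState] fun x => x.1 := by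
  obtain ⟨K, hstep⟩ := h.exists_integral_norm_pow_four_succ_le hc hβ hS
  have absorb : ∀ᶠ t : ℝ in 𝓝[>] 0, 0 < t ∧ K * t ^ 3 ≤ c / 2 * t := by
    have small : ∀ᶠ t : ℝ in 𝓝 0, K * t ^ 2 < c / 2 :=
      (by fun_prop : Continuous fun t : ℝ => K * t ^ 2).tendsto' 0 0 (by simp)
        |>.eventually (gt_mem_nhds (half_pos hc))
    filter_upwards [self_mem_nhdsWithin, nhdsWithin_le_nhds small] with t (ht : 0 < t) hsmall
    exact ⟨ht, by nlinarith⟩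
  have transformed : (fun x => lpNorm (S ∘ z x) 4 P ^ 4) =O[steadyState] fun x => x.1 ^ 2 := by
    refine isBigO_of_contraction (a := fun t => c / 2 * t) (c := fun t => t ^ 2)
      (r := fun x => K * x.1 ^ 3) (eventually_pos_and_mul_le_one (half_pos hc))
      (absorb.mono fun t ht => pow_pos ht.1 2) (eventually_curry_iff.2 ?_) ?_
    · filter_upwards [hstep, absorb] with t hstep ⟨_, habsorb⟩
      refine .of_forall fun i => ?_
      simp only [lpNorm_four_pow (S.comp_memLp' (h.memLp _)).1, Function.comp_apply]
      rw [Real.norm_of_nonneg (integral_nonneg fun ω => by positivity),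
        Real.norm_of_nonneg (integral_nonneg fun ω => by positivity)]
      have : 0 ≤ ∫ ω, ‖S (z (t, i) ω)‖ ^ 4 ∂P := integral_nonneg fun ω => by positivity
      nlinarith [hstep i]
    · refine ((Asymptotics.isBigO_refl _ _).const_mul_left (K / (c / 2))).congr_left fun x => ?_
      field_simp
  refine .of_pow two_ne_zero (.trans (.of_bound (β ^ 4) (.of_forall fun x => ?_)) transformed)
  rw [Pi.pow_apply, ← pow_mul, Real.norm_of_nonneg (pow_nonneg lpNorm_nonneg _),
    Real.norm_of_nonneg (pow_nonneg lpNorm_nonneg _), lpNorm_four_pow (h.memLp x).1,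
    lpNorm_four_pow (S.comp_memLp' (h.memLp x)).1]
  exact integral_norm_pow_le_mul
    ((S.comp_memLp' (h.memLp x)).integrable_norm_pow four_ne_zero) fun ω => hβ _

end FourthMoment

theorem isLittleO_lpNorm_two (h : IsNoisyRecursion P ℱ L g z s)
    (hz : (fun x => lpNorm (z x) 4 P ^ 2) =O[steadyState] fun x => x.1) :
    (fun x => lpNorm (z x) 2 P) =o[steadyState] fun _ => (1 : ℝ) := by
  refine Asymptotics.IsBigO.trans_isLittleO (.of_bound' (.of_forall fun x => ?_))
    ((Asymptotics.isLittleO_one_iff ℝ).2 (tendsto_zero_of_sq_isBigO_fst hz))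
  rw [Real.norm_of_nonneg lpNorm_nonneg, Real.norm_of_nonneg lpNorm_nonneg]
  exact h.lpNorm_two_le x

theorem noise_isBigO_lpNorm_two (h : IsNoisyRecursion P ℱ L g z s)
    (hz : (fun x => lpNorm (z x) 4 P ^ 2) =O[steadyState] fun x => x.1) :
    (fun x => lpNorm (s x) 2 P) =O[steadyState] fun _ => (1 : ℝ) := by
  obtain ⟨K, -, hK⟩ := h.exists_noise_fourth_le
  have state_isBigO : (fun x => lpNorm (z x) 4 P ^ 4) =O[steadyState] fun _ => (1 : ℝ) := by
    have fst_isBigO : (fun x : ℝ × ℕ => x.1) =O[steadyState] fun _ => (1 : ℝ) :=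
      (tendsto_fst_steadyState.mono_right nhdsWithin_le_nhds).isBigO_one ℝ
    simpa [← pow_mul] using! (hz.trans fst_isBigO).pow 2
  have bound_isBigO : (fun x => K * (lpNorm (z x) 4 P ^ 4 + 1)) =O[steadyState]
      fun _ => (1 : ℝ) := (state_isBigO.add (Asymptotics.isBigO_refl _ _)).const_mul_left K
  refine .of_pow four_ne_zero (.trans (.of_bound' (.of_forall fun x => ?_))
    (bound_isBigO.congr_right fun _ => (one_pow 4).symm))
  rw [Pi.pow_apply, Real.norm_of_nonneg (pow_nonneg lpNorm_nonneg 4)]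
  calc lpNorm (s x) 2 P ^ 4 ≤ lpNorm (s x) 4 P ^ 4 :=
        pow_le_pow_left₀ lpNorm_nonneg
          (lpNorm_le_lpNorm_of_exponent_le (by norm_num) (h.noise_memLp x)) 4
    _ ≤ K * (lpNorm (z x) 4 P ^ 4 + 1) := by
      rw [lpNorm_four_pow (h.noise_memLp x).1, lpNorm_four_pow (h.memLp x).1]
      exact hK x
    _ ≤ _ := le_abs_self _

section SecondMoment

variable [NormedSpace ℝ W]

theorem lpNorm_two_succ_le (h : IsNoisyRecursion P ℱ L g z s) {C : ℝ} (hC0 : 0 ≤ C)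
    (hC : ∀ x, ‖g x‖ ≤ C * ‖x‖) {R : V →L[ℝ] W} {r : ℝ} (hr : 0 ≤ r)
    (hR : ∀ x, ‖R (L x)‖ ≤ r * ‖R x‖) (t : ℝ) (i : ℕ) :
    lpNorm (fun ω => R (z (t, i + 1) ω)) 2 P ≤ r * lpNorm (fun ω => R (z (t, i) ω)) 2 P +
      r * (|t| * (‖R‖ * (C * lpNorm (z (t, i)) 2 P + lpNorm (s (t, i)) 2 P))) := by
  have hg := h.memLp_drift_two (t, i)
  have hs := h.noise_memLp_two (t, i)
  have hRz := R.comp_memLp' (h.memLp_two (t, i))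
  have hRu := (R.comp_memLp' (hg.add hs)).const_smul t
  have increment_le : lpNorm ((fun ω => g (z (t, i) ω)) + s (t, i)) 2 P ≤
      C * lpNorm (z (t, i)) 2 P + lpNorm (s (t, i)) 2 P :=
    (lpNorm_add_le hg one_le_two).trans (by
      gcongr; exact lpNorm_le_mul_lpNorm (h.memLp_two _) hC0 fun ω => hC _)
  calc lpNorm (fun ω => R (z (t, i + 1) ω)) 2 P
      ≤ r * lpNorm (R ∘ z (t, i) + t • R ∘ ((fun ω => g (z (t, i) ω)) + s (t, i))) 2 P := by
        refine lpNorm_le_mul_lpNorm (hRz.add hRu) hr fun ω => ?_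
        simpa [h.step] using hR (z (t, i) ω + t • (g (z (t, i) ω) + s (t, i) ω))
    _ ≤ r * (lpNorm (R ∘ z (t, i)) 2 P +
          |t| * (‖R‖ * (C * lpNorm (z (t, i)) 2 P + lpNorm (s (t, i)) 2 P))) := by
        gcongr
        refine (lpNorm_add_le hRz one_le_two).trans (add_le_add_right ?_ _)
        rw [lpNorm_const_smul, coe_nnnorm, Real.norm_eq_abs]
        gcongr
        refine (lpNorm_le_mul_lpNorm (hg.add hs) (norm_nonneg R) fun ω => R.le_opNorm _).trans ?_
        gcongr
    _ = _ := mul_add _ _ _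

theorem isBigO_lpNorm_two_of_contraction (h : IsNoisyRecursion P ℱ L g z s)
    (hz : (fun x => lpNorm (z x) 4 P ^ 2) =O[steadyState] fun x => x.1)
    {R : V →L[ℝ] W} {r : ℝ} (hr : 0 ≤ r) (hr1 : r < 1) (hR : ∀ x, ‖R (L x)‖ ≤ r * ‖R x‖) :
    (fun x => lpNorm (fun ω => R (z x ω)) 2 P) =O[steadyState] fun x => x.1 := by
  obtain ⟨C, hC0, hC⟩ := h.exists_norm_drift_le
  have bounded : (fun x => r * (‖R‖ * (C * lpNorm (z x) 2 P + lpNorm (s x) 2 P)))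
      =O[steadyState] fun _ => 1 - r :=
    (((((h.isLittleO_lpNorm_two hz).isBigO.const_mul_left C).add
      (h.noise_isBigO_lpNorm_two hz)).const_mul_left ‖R‖).const_mul_left r).trans
      (Asymptotics.isBigO_const_const 1 (sub_pos.2 hr1).ne' _)
  refine isBigO_of_contraction (l := 𝓝[>] 0) (a := fun _ => 1 - r) (c := fun t => t)
    (.of_forall fun _ => ⟨sub_pos.2 hr1, sub_le_self 1 hr⟩) self_mem_nhdsWithin
    (.of_forall fun x => ?_)
    (((bounded.mul (Asymptotics.isBigO_refl (fun x : ℝ × ℕ => x.1) _).abs_left)).congr_left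
      fun x => (by ring : _ = r * (|x.1| *
        (‖R‖ * (C * lpNorm (z x) 2 P + lpNorm (s x) 2 P)))))
  rw [Real.norm_of_nonneg lpNorm_nonneg, Real.norm_of_nonneg lpNorm_nonneg, sub_sub_cancel]
  exact h.lpNorm_two_succ_le hC0 hC hr hR x.1 x.2

end SecondMoment

end IsNoisyRecursion

end NoisyRecursion

section SteadyStateVariance

theorem integral_mul_add_mul_sq {Ω : Type*} {mΩ : MeasurableSpace Ω} {P : Measure Ω} {X Y : Ω → ℝ}
    (hX : MemLp X 2 P) (hY : MemLp Y 2 P) (a b : ℝ) :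
    ∫ ω, (a * X ω + b * Y ω) ^ 2 ∂P =
      a ^ 2 * ∫ ω, X ω ^ 2 ∂P + 2 * (a * b) * ∫ ω, X ω * Y ω ∂P + b ^ 2 * ∫ ω, Y ω ^ 2 ∂P := by
  have hX_sq : Integrable (fun ω => a ^ 2 * X ω ^ 2) P := hX.integrable_sq.const_mul _
  have hXY : Integrable (fun ω => 2 * (a * b) * (X ω * Y ω)) P :=
    (hX.integrable_mul hY).const_mul _
  have hX_sq_add : Integrable (fun ω => a ^ 2 * X ω ^ 2 + 2 * (a * b) * (X ω * Y ω)) P :=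
    hX_sq.add hXY
  have hY_sq : Integrable (fun ω => b ^ 2 * Y ω ^ 2) P := hY.integrable_sq.const_mul _
  have expand (ω : Ω) : (a * X ω + b * Y ω) ^ 2 =
      a ^ 2 * X ω ^ 2 + 2 * (a * b) * (X ω * Y ω) + b ^ 2 * Y ω ^ 2 := by ring
  simp_rw [expand]
  rw [integral_add hX_sq_add hY_sq, integral_add hX_sq hXY, integral_const_mul,
    integral_const_mul, integral_const_mul]

variable {Ω : Type*} [mΩ : MeasurableSpace Ω] {P : Measure Ω} [IsProbabilityMeasure P]
  {ℱ : Filtration ℕ mΩ} {V : Type*} [NormedAddCommGroup V] [NormedSpace ℝ V]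
  {L : V →L[ℝ] V} {g : V → V} {z s : ℝ × ℕ → Ω → V}

namespace IsNoisyRecursion

theorem integral_functional_sq_succ [CompleteSpace V] (h : IsNoisyRecursion P ℱ L g z s)
    {ℓ : V →L[ℝ] ℝ} (hℓ : ∀ x, ℓ (L x) = ℓ x) (t : ℝ) (i : ℕ) :
    ∫ ω, ℓ (z (t, i + 1) ω) ^ 2 ∂P = ∫ ω, (ℓ (z (t, i) ω) + t * ℓ (g (z (t, i) ω))) ^ 2 ∂P +
      t ^ 2 * ∫ ω, ℓ (s (t, i) ω) ^ 2 ∂P := by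
  have drift_measurable : StronglyMeasurable[ℱ i] fun ω =>
      ℓ (z (t, i) ω) + t * ℓ (g (z (t, i) ω)) := by
    have := h.drift_continuous
    exact Continuous.comp_stronglyMeasurable (g := fun x => ℓ x + t * ℓ (g x)) (by fun_prop)
      (h.stronglyMeasurable (t, i))
  have orthogonal := integral_norm_add_sq_of_condExp_eq_zero (ℱ.le i) drift_measurable
    ((ℓ.comp_memLp' (h.memLp_two _)).add ((ℓ.comp_memLp' (h.memLp_drift_two _)).const_mul t))
    ((ℓ.comp_memLp' (h.noise_memLp_two (t, i))).const_smul t)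
    (condExp_clm_smul_eq_zero ℓ t ((h.noise_memLp_two _).integrable one_le_two)
      (h.noise_condExp (t, i)))
  simpa [h.step, hℓ, mul_add, mul_pow, integral_const_mul, add_assoc] using orthogonal

theorem integral_functional_sq_succ_eq [CompleteSpace V] (h : IsNoisyRecursion P ℱ L g z s)
    {ℓ : V →L[ℝ] ℝ} (hℓ : ∀ x, ℓ (L x) = ℓ x) (c t : ℝ) (i : ℕ) :
    ∫ ω, ℓ (z (t, i + 1) ω) ^ 2 ∂P = (1 - c * t) ^ 2 * ∫ ω, ℓ (z (t, i) ω) ^ 2 ∂P +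
      2 * t * (1 - c * t) * ∫ ω, ℓ (z (t, i) ω) *
        (ℓ (g (z (t, i) ω)) + c * ℓ (z (t, i) ω)) ∂P +
      t ^ 2 * (∫ ω, (ℓ (g (z (t, i) ω)) + c * ℓ (z (t, i) ω)) ^ 2 ∂P +
        ∫ ω, ℓ (s (t, i) ω) ^ 2 ∂P) := by
  have state_memLp : MemLp (fun ω => ℓ (z (t, i) ω)) 2 P := ℓ.comp_memLp' (h.memLp_two _)
  have defect_memLp : MemLp (fun ω => ℓ (g (z (t, i) ω)) + c * ℓ (z (t, i) ω)) 2 P :=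
    (ℓ.comp_memLp' (h.memLp_drift_two _)).add (state_memLp.const_mul c)
  have regroup (ω : Ω) : ℓ (z (t, i) ω) + t * ℓ (g (z (t, i) ω)) =
      (1 - c * t) * ℓ (z (t, i) ω) + t * (ℓ (g (z (t, i) ω)) + c * ℓ (z (t, i) ω)) := by ring
  simp_rw [h.integral_functional_sq_succ hℓ, regroup]
  rw [integral_mul_add_mul_sq state_memLp defect_memLp]
  ring

theorem isLittleO_lpNorm_two_of_le (h : IsNoisyRecursion P ℱ L g z s)
    (hz : (fun x => lpNorm (z x) 4 P ^ 2) =O[steadyState] fun x => x.1)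
    {W : Type*} [NormedAddCommGroup W] {f : V → W} {C : ℝ} (hC : 0 ≤ C)
    (hf : ∀ x, ‖f x‖ ≤ C * ‖x‖) :
    (fun x => lpNorm (fun ω => f (z x ω)) 2 P) =o[steadyState] fun _ => (1 : ℝ) := by
  refine Asymptotics.IsBigO.trans_isLittleO (.of_bound C (.of_forall fun x => ?_))
    (h.isLittleO_lpNorm_two hz)
  rw [Real.norm_of_nonneg lpNorm_nonneg, Real.norm_of_nonneg lpNorm_nonneg]
  exact lpNorm_le_mul_lpNorm (h.memLp_two x) hC fun ω => hf _

theorem isLittleO_variance_remainder (h : IsNoisyRecursion P ℱ L g z s)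
    (hz : (fun x => lpNorm (z x) 4 P ^ 2) =O[steadyState] fun x => x.1) {ℓ : V →L[ℝ] ℝ} {c v : ℝ}
    (hdefect : (fun x => lpNorm (fun ω => ℓ (g (z x ω)) + c * ℓ (z x ω)) 2 P)
      =O[steadyState] fun x => x.1)
    (hnoise : Tendsto (fun x => ∫ ω, ℓ (s x ω) ^ 2 ∂P) steadyState (𝓝 v)) :
    (fun x => x.1 * (x.1 * (c ^ 2 * ∫ ω, ℓ (z x ω) ^ 2 ∂P +
      ∫ ω, (ℓ (g (z x ω)) + c * ℓ (z x ω)) ^ 2 ∂P + (∫ ω, ℓ (s x ω) ^ 2 ∂P - v))) +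
      2 * (x.1 * (1 - c * x.1) * ∫ ω, ℓ (z x ω) * (ℓ (g (z x ω)) + c * ℓ (z x ω)) ∂P))
      =o[steadyState] fun x => x.1 * x.1 := by
  have state_memLp (x) : MemLp (fun ω => ℓ (z x ω)) 2 P := ℓ.comp_memLp' (h.memLp_two x)
  have defect_memLp (x) : MemLp (fun ω => ℓ (g (z x ω)) + c * ℓ (z x ω)) 2 P :=
    (ℓ.comp_memLp' (h.memLp_drift_two x)).add ((state_memLp x).const_mul c)
  have state_isLittleO := h.isLittleO_lpNorm_two_of_le hz (norm_nonneg ℓ) ℓ.le_opNorm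
  have state_sq_tendsto : Tendsto (fun x => ∫ ω, ℓ (z x ω) ^ 2 ∂P) steadyState (𝓝 0) := by
    have := (((Asymptotics.isLittleO_one_iff ℝ).1 state_isLittleO).pow 2)
    simpa [lpNorm_two_sq (state_memLp _).1] using this
  have defect_sq_tendsto : Tendsto (fun x => ∫ ω, (ℓ (g (z x ω)) + c * ℓ (z x ω)) ^ 2 ∂P)
      steadyState (𝓝 0) := by
    have := ((hdefect.trans_tendsto (tendsto_fst_steadyState.mono_right
      nhdsWithin_le_nhds)).pow 2)
    simpa [lpNorm_two_sq (defect_memLp _).1] using this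
  have cross_isLittleO : (fun x => ∫ ω, ℓ (z x ω) * (ℓ (g (z x ω)) + c * ℓ (z x ω)) ∂P)
      =o[steadyState] fun x => x.1 := by
    refine Asymptotics.IsBigO.trans_isLittleO (.of_bound' (.of_forall fun x => ?_))
      ((state_isLittleO.mul_isBigO hdefect).congr_right fun x => one_mul _)
    have := abs_integral_inner_le (state_memLp x) (defect_memLp x)
    simpa [mul_comm, abs_of_nonneg lpNorm_nonneg] using this
  have quadratic_tendsto : Tendsto (fun x => c ^ 2 * ∫ ω, ℓ (z x ω) ^ 2 ∂P +
      ∫ ω, (ℓ (g (z x ω)) + c * ℓ (z x ω)) ^ 2 ∂P + (∫ ω, ℓ (s x ω) ^ 2 ∂P - v))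
      steadyState (𝓝 0) := by
    simpa using ((state_sq_tendsto.const_mul (c ^ 2)).add defect_sq_tendsto).add
      (hnoise.sub_const v)
  have coeff_isBigO : (fun x : ℝ × ℕ => 1 - c * x.1) =O[steadyState] fun _ => (1 : ℝ) :=
    (((tendsto_fst_steadyState.mono_right nhdsWithin_le_nhds).const_mul c).const_sub 1).isBigO_one ℝ
  have self_isBigO := Asymptotics.isBigO_refl (fun x : ℝ × ℕ => x.1) steadyState
  have quadratic_isLittleO := self_isBigO.mul_isLittleO (self_isBigO.mul_isLittleO
    ((Asymptotics.isLittleO_one_iff ℝ).2 quadratic_tendsto))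
  have linear_isLittleO :=
    ((self_isBigO.mul coeff_isBigO).mul_isLittleO cross_isLittleO).const_mul_left 2
  simp only [mul_one] at quadratic_isLittleO linear_isLittleO
  exact quadratic_isLittleO.add linear_isLittleO

theorem isLittleO_integral_functional_sq_sub [CompleteSpace V] (h : IsNoisyRecursion P ℱ L g z s)
    (hz : (fun x => lpNorm (z x) 4 P ^ 2) =O[steadyState] fun x => x.1)
    {ℓ : V →L[ℝ] ℝ} (hℓ : ∀ x, ℓ (L x) = ℓ x) {c v : ℝ} (hc : 0 < c)
    (hdefect : (fun x => lpNorm (fun ω => ℓ (g (z x ω)) + c * ℓ (z x ω)) 2 P)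
      =O[steadyState] fun x => x.1)
    (hnoise : Tendsto (fun x => ∫ ω, ℓ (s x ω) ^ 2 ∂P) steadyState (𝓝 v)) :
    (fun x => ∫ ω, ℓ (z x ω) ^ 2 ∂P - x.1 * (v / (2 * c))) =o[steadyState] fun x => x.1 := by
  have recursion (x : ℝ × ℕ) : ∫ ω, ℓ (z (x.1, x.2 + 1) ω) ^ 2 ∂P - x.1 * (v / (2 * c)) =
      (1 - 2 * c * x.1) * (∫ ω, ℓ (z x ω) ^ 2 ∂P - x.1 * (v / (2 * c))) +
      (x.1 * (x.1 * (c ^ 2 * ∫ ω, ℓ (z x ω) ^ 2 ∂P +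
        ∫ ω, (ℓ (g (z x ω)) + c * ℓ (z x ω)) ^ 2 ∂P + (∫ ω, ℓ (s x ω) ^ 2 ∂P - v))) +
        2 * (x.1 * (1 - c * x.1) * ∫ ω, ℓ (z x ω) * (ℓ (g (z x ω)) + c * ℓ (z x ω)) ∂P)) := by
    rw [h.integral_functional_sq_succ_eq hℓ c]
    field_simp
    ring
  have contraction := eventually_pos_and_mul_le_one (mul_pos two_pos hc)
  refine isLittleO_of_contraction (l := 𝓝[>] 0) (a := fun t => 2 * c * t) (c := fun t => t)
    contraction self_mem_nhdsWithin ?_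
    (((h.isLittleO_variance_remainder hz hdefect hnoise).trans_isBigO
      ((Asymptotics.isBigO_refl _ _).const_mul_right (mul_pos two_pos hc).ne')).congr_right
        fun x => (mul_assoc (2 * c) x.1 x.1).symm).abs_left
  filter_upwards [tendsto_fst_steadyState.eventually contraction] with x hx
  rw [recursion]
  refine (norm_add_le _ _).trans_eq ?_
  rw [norm_mul, Real.norm_of_nonneg (sub_nonneg.2 hx.2), Real.norm_eq_abs (_ + _)]

/-- Balancing the contraction `1 - 2ct` of `E ℓ(z)²` against the injected variance `t² v` gives the
limit. -/
theorem tendsto_integral_functional_sq_div [CompleteSpace V] (h : IsNoisyRecursion P ℱ L g z s)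
    (hz : (fun x => lpNorm (z x) 4 P ^ 2) =O[steadyState] fun x => x.1)
    {ℓ : V →L[ℝ] ℝ} (hℓ : ∀ x, ℓ (L x) = ℓ x) {c v : ℝ} (hc : 0 < c)
    (hdefect : (fun x => lpNorm (fun ω => ℓ (g (z x ω)) + c * ℓ (z x ω)) 2 P)
      =O[steadyState] fun x => x.1)
    (hnoise : Tendsto (fun x => ∫ ω, ℓ (s x ω) ^ 2 ∂P) steadyState (𝓝 v)) :
    Tendsto (fun x => (∫ ω, ℓ (z x ω) ^ 2 ∂P) / x.1) steadyState (𝓝 (v / (2 * c))) := by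
  have excess_tendsto : Tendsto (fun x => (∫ ω, ℓ (z x ω) ^ 2 ∂P - x.1 * (v / (2 * c))) / x.1 +
      v / (2 * c)) steadyState (𝓝 (v / (2 * c))) := by
    simpa using (h.isLittleO_integral_functional_sq_sub hz hℓ hc hdefect hnoise
      ).tendsto_div_nhds_zero.add_const (v / (2 * c))
  refine excess_tendsto.congr' ?_
  filter_upwards [eventually_pos_steadyState] with x hx
  rw [sub_div, mul_div_cancel_left₀ _ hx.ne', sub_add_cancel]

theorem isBigO_lpNorm_defect (h : IsNoisyRecursion P ℱ L g z s)
    (hz : (fun x => lpNorm (z x) 4 P ^ 2) =O[steadyState] fun x => x.1)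
    {W : Type*} [NormedAddCommGroup W] [NormedSpace ℝ W] {R : V →L[ℝ] W}
    (hR : (fun x => lpNorm (fun ω => R (z x ω)) 2 P) =O[steadyState] fun x => x.1)
    {f : V → ℝ} {C : ℝ} (hf : ∀ x, |f x| ≤ C * (‖R x‖ + ‖x‖ ^ 2)) :
    (fun x => lpNorm (fun ω => f (z x ω)) 2 P) =O[steadyState] fun x => x.1 := by
  refine .trans (.of_bound |C| (.of_forall fun x => ?_)) (hR.add hz)
  have hRz : MemLp (fun ω => R (z x ω)) 2 P := R.comp_memLp' (h.memLp_two x)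
  have bound_nonneg (y : V) : 0 ≤ ‖R y‖ + ‖y‖ ^ 2 := by positivity
  rw [Real.norm_of_nonneg lpNorm_nonneg,
    Real.norm_of_nonneg (add_nonneg lpNorm_nonneg (sq_nonneg _))]
  calc lpNorm (fun ω => f (z x ω)) 2 P
      ≤ |C| * lpNorm ((fun ω => ‖R (z x ω)‖) + fun ω => ‖z x ω‖ ^ 2) 2 P := by
        refine lpNorm_le_mul_lpNorm (hRz.norm.add (memLp_norm_sq (h.memLp x))) (abs_nonneg C)
          fun ω => (hf _).trans ?_
        rw [Pi.add_apply, Real.norm_of_nonneg (bound_nonneg _)]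
        exact mul_le_mul_of_nonneg_right (le_abs_self C) (bound_nonneg _)
    _ ≤ |C| * (lpNorm (fun ω => R (z x ω)) 2 P + lpNorm (z x) 4 P ^ 2) := by
        rw [← lpNorm_norm_sq (h.memLp x).1, ← lpNorm_norm hRz.1]
        gcongr
        exact lpNorm_add_le hRz.norm one_le_two

theorem tendsto_integral_norm_sq_div_of_sub_isBigO {V : Type*} [NormedAddCommGroup V]
    [InnerProductSpace ℝ V] {L Q : V →L[ℝ] V} {g : V → V} {z s : ℝ × ℕ → Ω → V}
    (h : IsNoisyRecursion P ℱ L g z s)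
    (hz : (fun x => lpNorm (z x) 4 P ^ 2) =O[steadyState] fun x => x.1) {c : ℝ}
    (hQ : (fun x => lpNorm (fun ω => z x ω - Q (z x ω)) 2 P) =O[steadyState] fun x => x.1)
    (hQz : Tendsto (fun x => (∫ ω, ‖Q (z x ω)‖ ^ 2 ∂P) / x.1) steadyState (𝓝 c)) :
    Tendsto (fun x => (∫ ω, ‖z x ω‖ ^ 2 ∂P) / x.1) steadyState (𝓝 c) := by
  have hz2 (x) := h.memLp_two x
  have hQz2 (x) : MemLp (fun ω => Q (z x ω)) 2 P := Q.comp_memLp' (hz2 x)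
  have difference (x) : ∫ ω, ‖z x ω‖ ^ 2 ∂P - ∫ ω, ‖Q (z x ω)‖ ^ 2 ∂P =
      ∫ ω, inner ℝ (z x ω + Q (z x ω)) (z x ω - Q (z x ω)) ∂P := by
    rw [← integral_sub ((hz2 x).integrable_norm_pow two_ne_zero)
      ((hQz2 x).integrable_norm_pow two_ne_zero)]
    refine integral_congr_ae (ae_of_all _ fun ω => ?_)
    simp only [inner_add_left, inner_sub_right, real_inner_self_eq_norm_sq, real_inner_comm]
    ring
  have sum_isLittleO : (fun x => lpNorm (fun ω => z x ω + Q (z x ω)) 2 P) =o[steadyState]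
      fun _ => (1 : ℝ) :=
    h.isLittleO_lpNorm_two_of_le hz (C := 1 + ‖Q‖) (by positivity) fun x => by
      simpa [add_mul] using norm_add_le_of_le le_rfl (Q.le_opNorm x)
  have difference_isLittleO : (fun x => ∫ ω, ‖z x ω‖ ^ 2 ∂P - ∫ ω, ‖Q (z x ω)‖ ^ 2 ∂P)
      =o[steadyState] fun x => x.1 := by
    refine Asymptotics.IsBigO.trans_isLittleO (.of_bound' (.of_forall fun x => ?_))
      ((sum_isLittleO.mul_isBigO hQ).congr_right fun x => one_mul _)
    rw [difference, Real.norm_of_nonneg (mul_nonneg lpNorm_nonneg lpNorm_nonneg)]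
    exact abs_integral_inner_le ((hz2 x).add (hQz2 x)) ((hz2 x).sub (hQz2 x))
  simpa [← add_div] using difference_isLittleO.tendsto_div_nhds_zero.add hQz

end IsNoisyRecursion
end SteadyStateVariance

/-! ### Dissipative drifts -/

theorem norm_sq_le_two_mul_norm_add_sq {E : Type*} [SeminormedAddCommGroup E] (x y : E) :
    ‖x‖ ^ 2 ≤ 2 * ‖x + y‖ ^ 2 + 2 * ‖y‖ ^ 2 := by
  calc ‖x‖ ^ 2 ≤ (‖x + y‖ + ‖y‖) ^ 2 := by gcongr; simpa using norm_sub_le (x + y) y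
    _ ≤ 2 * ‖x + y‖ ^ 2 + 2 * ‖y‖ ^ 2 := by linarith [add_sq_le (a := ‖x + y‖) (b := ‖y‖)]

theorem norm_real_smul_sq {E : Type*} [SeminormedAddCommGroup E] [NormedSpace ℝ E] (t : ℝ)
    (x : E) : ‖t • x‖ ^ 2 = t ^ 2 * ‖x‖ ^ 2 := by
  rw [norm_smul, mul_pow, Real.norm_eq_abs, sq_abs]

section Dissipative

variable {V W U : Type*} [NormedAddCommGroup V] [NormedSpace ℝ V] [NormedAddCommGroup W]
  [InnerProductSpace ℝ W] [NormedAddCommGroup U] [NormedSpace ℝ U]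

theorem norm_clm_sq_le_of_norm_le (T : V →L[ℝ] U) {y z : V} {C : ℝ} (h : ‖y‖ ≤ C * ‖z‖) :
    ‖T y‖ ^ 2 ≤ (‖T‖ * C) ^ 2 * ‖z‖ ^ 2 := by
  rw [← mul_pow, mul_assoc]
  gcongr
  exact T.le_opNorm_of_le h

variable {S : V →L[ℝ] W} {T : V →L[ℝ] U} {L : V → V} {g : V → V} {X : V → ℝ} {C δ c : ℝ}

theorem norm_sq_dissipative_step_le (hδ : 0 < δ) (hg : ∀ z, ‖g z‖ ≤ C * ‖z‖)
    (hL : ∀ z, ‖S (L z)‖ ^ 2 ≤ ‖S z‖ ^ 2 - δ * ‖T z‖ ^ 2)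
    (hX : ∀ z, inner ℝ (S z) (S (g z)) ≤ -X z) (hcoer : ∀ z, c * ‖z‖ ^ 2 ≤ X z + ‖T z‖ ^ 2)
    {t : ℝ} (ht : 0 < t) (htδ : 4 * t ≤ δ) (z : V) :
    ‖S (L (z + t • g z))‖ ^ 2 ≤
      ‖S z‖ ^ 2 - 2 * t * c * ‖z‖ ^ 2
        + t ^ 2 * (((‖S‖ * C) ^ 2 + δ * (‖T‖ * C) ^ 2) * ‖z‖ ^ 2) := by
  have expand : ‖S (z + t • g z)‖ ^ 2 =
      ‖S z‖ ^ 2 + 2 * (t * inner ℝ (S z) (S (g z))) + t ^ 2 * ‖S (g z)‖ ^ 2 := by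
    rw [map_add, map_smul, norm_add_sq_real, real_inner_smul_right, norm_real_smul_sq]
  have dissipation : t * inner ℝ (S z) (S (g z)) ≤ t * -X z := by gcongr; exact hX z
  have drift_sq : t ^ 2 * ‖S (g z)‖ ^ 2 ≤ t ^ 2 * ((‖S‖ * C) ^ 2 * ‖z‖ ^ 2) := by
    gcongr; exact norm_clm_sq_le_of_norm_le S (hg z)
  have deviation : δ * ‖T z‖ ^ 2 ≤
      2 * (δ * ‖T (z + t • g z)‖ ^ 2) + 2 * (δ * (t ^ 2 * ((‖T‖ * C) ^ 2 * ‖z‖ ^ 2))) := by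
    calc δ * ‖T z‖ ^ 2 ≤ δ * (2 * ‖T z + t • T (g z)‖ ^ 2 + 2 * ‖t • T (g z)‖ ^ 2) := by
          gcongr; exact norm_sq_le_two_mul_norm_add_sq _ _
      _ ≤ δ * (2 * ‖T (z + t • g z)‖ ^ 2 + 2 * (t ^ 2 * ((‖T‖ * C) ^ 2 * ‖z‖ ^ 2))) := by
          rw [norm_real_smul_sq, map_add, map_smul]
          gcongr; exact norm_clm_sq_le_of_norm_le T (hg z)
      _ = _ := by ring
  have small_step : 4 * t * ‖T z‖ ^ 2 ≤ δ * ‖T z‖ ^ 2 := by gcongr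
  have coercive : t * (c * ‖z‖ ^ 2) ≤ t * (X z + ‖T z‖ ^ 2) := by gcongr; exact hcoer z
  linarith [hL (z + t • g z)]

theorem exists_contraction_of_dissipative (hδ : 0 < δ) (hc : 0 < c) (hg : ∀ z, ‖g z‖ ≤ C * ‖z‖)
    (hL : ∀ z, ‖S (L z)‖ ^ 2 ≤ ‖S z‖ ^ 2 - δ * ‖T z‖ ^ 2)
    (hX : ∀ z, inner ℝ (S z) (S (g z)) ≤ -X z) (hcoer : ∀ z, c * ‖z‖ ^ 2 ≤ X z + ‖T z‖ ^ 2) :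
    ∃ a, 0 < a ∧ ∀ᶠ t in 𝓝[>] (0 : ℝ), ∀ z, ‖S (L (z + t • g z))‖ ≤ (1 - a * t) * ‖S z‖ := by
  set K := (‖S‖ * C) ^ 2 + δ * (‖T‖ * C) ^ 2
  have : 0 ≤ K := by positivity
  set a := c / (2 * (‖S‖ ^ 2 + 1)) with ha
  have ha0 : 0 < a := by positivity
  refine ⟨a, ha0, ?_⟩
  filter_upwards [eventually_pos_and_mul_le_one (show 0 < 4 / δ by positivity),
    eventually_pos_and_mul_le_one (show 0 < (K + 1) / c by positivity),
    eventually_pos_and_mul_le_one ha0, self_mem_nhdsWithin] with t htδ htK hta ht z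
  have ht : 0 < t := ht
  have htδ : 4 * t ≤ δ := by simpa [div_mul_eq_mul_div, div_le_one hδ] using htδ.2
  have htK : t * K ≤ c := by
    have : (K + 1) * t ≤ c := by simpa [div_mul_eq_mul_div, div_le_one hc] using htK.2
    linarith
  refine le_of_sq_le_sq ?_ (mul_nonneg (sub_nonneg.2 hta.2) (norm_nonneg _))
  calc ‖S (L (z + t • g z))‖ ^ 2
      ≤ ‖S z‖ ^ 2 - 2 * t * c * ‖z‖ ^ 2 + t ^ 2 * (K * ‖z‖ ^ 2) :=
        norm_sq_dissipative_step_le hδ hg hL hX hcoer ht htδ z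
    _ = ‖S z‖ ^ 2 - 2 * t * c * ‖z‖ ^ 2 + t * (t * K) * ‖z‖ ^ 2 := by ring
    _ ≤ ‖S z‖ ^ 2 - 2 * t * c * ‖z‖ ^ 2 + t * c * ‖z‖ ^ 2 := by gcongr
    _ = ‖S z‖ ^ 2 - 2 * (a * t) * ((‖S‖ ^ 2 + 1) * ‖z‖ ^ 2) := by rw [ha]; field_simp; ring
    _ ≤ ‖S z‖ ^ 2 - 2 * (a * t) * ‖S z‖ ^ 2 := by
        gcongr
        calc ‖S z‖ ^ 2 ≤ (‖S‖ * ‖z‖) ^ 2 := by gcongr; exact S.le_opNorm z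
          _ ≤ (‖S‖ ^ 2 + 1) * ‖z‖ ^ 2 := by rw [mul_pow]; gcongr; linarith
    _ ≤ ((1 - a * t) * ‖S z‖) ^ 2 := by linarith [sq_nonneg (a * t * ‖S z‖)]

end Dissipative

/-! ### Weighted network vectors -/

theorem exists_pos_mul_norm_sq_le {E : Type*} [NormedAddCommGroup E] [NormedSpace ℝ E]
    [FiniteDimensional ℝ E] {f : E → ℝ} (hf : Continuous f)
    (smul : ∀ (c : ℝ) x, f (c • x) = c ^ 2 * f x) (pos : ∀ x, x ≠ 0 → 0 < f x) :
    ∃ δ, 0 < δ ∧ ∀ x, δ * ‖x‖ ^ 2 ≤ f x := by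
  have zero : f 0 = 0 := by simpa using smul 0 0
  rcases subsingleton_or_nontrivial E with hE | hE
  · exact ⟨1, one_pos, fun x => by simp [Subsingleton.elim x 0, zero]⟩
  obtain ⟨x₀, hx₀, hmin⟩ := (isCompact_sphere (0 : E) 1).exists_isMinOn
    (NormedSpace.sphere_nonempty.2 zero_le_one) hf.continuousOn
  refine ⟨f x₀, pos x₀ (ne_zero_of_mem_unit_sphere ⟨x₀, hx₀⟩), fun x => ?_⟩
  rcases eq_or_ne x 0 with rfl | hx
  · simp [zero]
  have normalized : f x₀ ≤ ‖x‖⁻¹ ^ 2 * f x := by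
    rw [← smul]
    exact hmin (by simp [norm_smul, hx])
  have hx' : ‖x‖ ≠ 0 := norm_ne_zero_iff.2 hx
  calc f x₀ * ‖x‖ ^ 2 ≤ (‖x‖⁻¹ ^ 2 * f x) * ‖x‖ ^ 2 := by gcongr
    _ = f x := by field_simp

theorem sum_mul_norm_sub_sq {ι E : Type*} [Fintype ι] [NormedAddCommGroup E]
    [InnerProductSpace ℝ E] {w : ι → ℝ} (hw : ∑ i, w i = 1) (y : ι → E) :
    ∑ i, w i * ‖y i - ∑ j, w j • y j‖ ^ 2 = ∑ i, w i * ‖y i‖ ^ 2 - ‖∑ j, w j • y j‖ ^ 2 := by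
  set b := ∑ j, w j • y j with hb
  have inner_mean : ∑ i, w i * inner ℝ (y i) b = ‖b‖ ^ 2 := by
    rw [← real_inner_self_eq_norm_sq]
    nth_rewrite 2 [hb]
    simp_rw [sum_inner, real_inner_smul_left]
  calc ∑ i, w i * ‖y i - b‖ ^ 2
      = ∑ i, (w i * ‖y i‖ ^ 2 - 2 * (w i * inner ℝ (y i) b) + w i * ‖b‖ ^ 2) :=
        Finset.sum_congr rfl fun i _ => by rw [norm_sub_sq_real]; ring
    _ = ∑ i, w i * ‖y i‖ ^ 2 - ‖b‖ ^ 2 := by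
        rw [Finset.sum_add_distrib, Finset.sum_sub_distrib, ← Finset.mul_sum, inner_mean,
          ← Finset.sum_mul, hw]
        ring

/-- Network vectors with one block in `E` per agent; `NetVec N M` is the case of Euclidean `E`. -/
abbrev BlockVec (N : ℕ) (E : Type*) : Type _ := PiLp 2 (fun _ : Fin N => E)

section BlockMap

variable {N : ℕ} {E : Type*} [NormedAddCommGroup E] [InnerProductSpace ℝ E]

/-- The action `z ↦ (B ⊗ I) z` of an `N × N` matrix on network vectors. -/
noncomputable def blockMap (B : Matrix (Fin N) (Fin N) ℝ) : BlockVec N E →L[ℝ] BlockVec N E where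
  toFun z := WithLp.toLp 2 fun k => ∑ l, B k l • z l
  map_add' x y := by
    refine PiLp.ext fun k => ?_
    simp [smul_add, Finset.sum_add_distrib]
  map_smul' c x := by
    refine PiLp.ext fun k => ?_
    simp [Finset.smul_sum, smul_comm c]
  cont := by fun_prop

theorem blockMap_apply (B : Matrix (Fin N) (Fin N) ℝ) (z : BlockVec N E) (k : Fin N) :
    blockMap B z k = ∑ l, B k l • z l := rfl

theorem blockMap_mul (B C : Matrix (Fin N) (Fin N) ℝ) (z : BlockVec N E) :
    blockMap (B * C) z = blockMap B (blockMap C z) := by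
  refine PiLp.ext fun k => ?_
  simp only [blockMap_apply, Matrix.mul_apply, Finset.sum_smul, Finset.smul_sum, smul_smul]
  exact Finset.sum_comm

theorem blockMap_diagonal (c : Fin N → ℝ) (z : BlockVec N E) (k : Fin N) :
    blockMap (Matrix.diagonal c) z k = c k • z k := by
  simp [blockMap_apply, Matrix.diagonal_apply, ite_smul]

/-- Multiplication of the `k`-th block by `√(p k)`, which turns the Euclidean norm into the
`p`-weighted one. -/
noncomputable def sqrtScale (p : Fin N → ℝ) : BlockVec N E →L[ℝ] BlockVec N E :=
  blockMap (Matrix.diagonal fun k => √(p k))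

variable {p : Fin N → ℝ}

theorem inner_sqrtScale (hp : ∀ k, 0 ≤ p k) (x y : BlockVec N E) :
    inner ℝ (sqrtScale p x) (sqrtScale p y) = ∑ k, p k * inner ℝ (x k) (y k) := by
  rw [PiLp.inner_apply]
  refine Finset.sum_congr rfl fun k _ => ?_
  rw [sqrtScale, blockMap_diagonal, blockMap_diagonal, real_inner_smul_left,
    real_inner_smul_right, ← mul_assoc, Real.mul_self_sqrt (hp k)]

theorem norm_sqrtScale_sq (hp : ∀ k, 0 ≤ p k) (x : BlockVec N E) :
    ‖sqrtScale p x‖ ^ 2 = ∑ k, p k * ‖x k‖ ^ 2 := by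
  simp_rw [← real_inner_self_eq_norm_sq, inner_sqrtScale hp]

theorem exists_norm_le_mul_norm_sqrtScale (hp : ∀ k, 0 < p k) :
    ∃ β, 0 ≤ β ∧ ∀ x : BlockVec N E, ‖x‖ ≤ β * ‖sqrtScale p x‖ := by
  refine ⟨‖blockMap (E := E) (Matrix.diagonal fun k => (√(p k))⁻¹)‖, by positivity, fun x => ?_⟩
  have left_inv : blockMap (Matrix.diagonal fun k => (√(p k))⁻¹) (sqrtScale p x) = x :=
    PiLp.ext fun k => by
      rw [sqrtScale, blockMap_diagonal, blockMap_diagonal,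
        inv_smul_smul₀ (Real.sqrt_pos.2 (hp k)).ne']
  exact (congrArg norm left_inv).ge.trans (ContinuousLinearMap.le_opNorm _ _)

end BlockMap

/-! ### Combination weights and Perron vectors -/

section Network

variable {N M G : ℕ} {nbr : Fin N → Finset (Fin N)} {group : Fin N → Fin G} {wo : NetVec N M}
  {A : Matrix (Fin N) (Fin N) ℝ} {p : Fin N → ℝ} {E : Type*} [NormedAddCommGroup E]
  [InnerProductSpace ℝ E]

theorem IsCombination.nonneg (hA : IsCombination nbr group A) (l k : Fin N) : 0 ≤ A l k := by
  by_cases h : l ∈ nbr k ∧ group l = group k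
  · exact (hA.pos l k h.1 h.2).le
  · exact (hA.zero l k h).ge

theorem IsCombination.eq_zero (hA : IsCombination nbr group A) {l k : Fin N}
    (h : group l ≠ group k) : A l k = 0 :=
  hA.zero l k fun hlk => h hlk.2

theorem IsPerronVector.exists_group_eq (hp : IsPerronVector group A p) (m : Fin G) :
    ∃ k, group k = m := by
  have : (groupAgents group m).Nonempty :=
    Finset.nonempty_of_sum_ne_zero (by rw [hp.sum_one m]; exact one_ne_zero)
  obtain ⟨k, hk⟩ := this
  exact ⟨k, (Finset.mem_filter.1 hk).2⟩

theorem IsPerronVector.exists_pos (hp : IsPerronVector group A p) (m : Fin G) :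
    ∃ k ∈ groupAgents group m, 0 < p k := by
  by_contra! h
  linarith [Finset.sum_nonpos h, hp.sum_one m]

theorem IsPerronVector.sum_mul (hA : IsCombination nbr group A) (hp : IsPerronVector group A p)
    (l : Fin N) : ∑ k, A l k * p k = p l := by
  rw [← hp.eigen (group l) l (by simp [groupAgents])]
  refine (Finset.sum_subset (Finset.subset_univ _) fun k _ hk => ?_).symm
  rw [hA.eq_zero fun h => hk (by simp [groupAgents, h]), zero_mul]

/- `max p 0 ≤ A (max p 0)` entrywise, and `A` preserves the sum of the entries. -/
theorem IsPerronVector.sum_mul_max_zero (hA : IsCombination nbr group A)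
    (hp : IsPerronVector group A p) (l : Fin N) :
    ∑ k, A l k * max (p k) 0 = max (p l) 0 := by
  have le_combine : ∀ l ∈ Finset.univ, max (p l) 0 ≤ ∑ k, A l k * max (p k) 0 := fun l _ => by
    refine max_le ?_ (Finset.sum_nonneg fun k _ => mul_nonneg (hA.nonneg l k) (le_max_right _ _))
    rw [← hp.sum_mul hA l]
    exact Finset.sum_le_sum fun k _ => mul_le_mul_of_nonneg_left (le_max_left _ _) (hA.nonneg l k)
  have sum_eq : ∑ l, max (p l) 0 = ∑ l, ∑ k, A l k * max (p k) 0 := by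
    rw [Finset.sum_comm]
    simp_rw [← Finset.sum_mul, hA.col_sum, one_mul]
  exact ((Finset.sum_eq_sum_iff_of_le le_combine).1 sum_eq l (Finset.mem_univ l)).symm

theorem IsPerronVector.pos (hgroup : IsGrouping nbr group wo) (hA : IsCombination nbr group A)
    (hp : IsPerronVector group A p) (k : Fin N) : 0 < p k := by
  have pos_of_link : ∀ l k, l ∈ nbr k ∧ group l = group k → 0 < p k → 0 < p l := by
    intro l k hlk hk
    have : 0 < max (p l) 0 := by
      rw [← hp.sum_mul_max_zero hA l]
      exact (mul_pos (hA.pos l k hlk.1 hlk.2) (lt_max_of_lt_left hk)).trans_le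
        (Finset.single_le_sum (f := fun k => A l k * max (p k) 0)
          (fun k _ => mul_nonneg (hA.nonneg l k) (le_max_right _ _)) (Finset.mem_univ k))
    simpa using this
  obtain ⟨j, hj, hpj⟩ := hp.exists_pos (group k)
  have path := hgroup.connected k j (Finset.mem_filter.1 hj).2.symm
  clear hj
  induction path using Relation.ReflTransGen.head_induction_on with
  | refl => exact hpj
  | head link _ ih => exact pos_of_link _ _ link ih

/-! ### Group means and group deviations -/

/-- The matrix that replaces every block by the `p`-weighted mean over its group. -/
def groupMean (group : Fin N → Fin G) (p : Fin N → ℝ) : Matrix (Fin N) (Fin N) ℝ :=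
  Matrix.of fun k l => if group l = group k then p l else 0

theorem groupMean_apply (k l : Fin N) :
    groupMean group p k l = if group l = group k then p l else 0 := rfl

theorem sum_groupMean (hp : IsPerronVector group A p) (k : Fin N) :
    ∑ l, groupMean group p k l = 1 := by
  rw [← hp.sum_one (group k), groupAgents, Finset.sum_filter]
  rfl

theorem groupMean_mul_transpose (hA : IsCombination nbr group A) (hp : IsPerronVector group A p) :
    groupMean group p * A.transpose = groupMean group p := by
  ext k l
  have same_group : ∀ j, groupMean group p k j * A l j =
      (if group l = group k then 1 else 0) * (A l j * p j) := fun j => by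
    rcases eq_or_ne (group l) (group j) with h | h
    · simp [groupMean_apply, h, mul_comm]
    · simp [hA.eq_zero h]
  simp_rw [Matrix.mul_apply, Matrix.transpose_apply, same_group, ← Finset.mul_sum, hp.sum_mul hA,
    groupMean_apply, ite_mul, one_mul, zero_mul]

theorem transpose_mul_groupMean (hA : IsCombination nbr group A) :
    A.transpose * groupMean group p = groupMean group p := by
  ext k l
  have same_group : ∀ j, A j k * groupMean group p j l = A j k * groupMean group p k l :=
    fun j => by
      rcases eq_or_ne (group j) (group k) with h | h
      · simp [groupMean_apply, h]
      · simp [hA.eq_zero h]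
  simp_rw [Matrix.mul_apply, Matrix.transpose_apply, same_group, ← Finset.sum_mul, hA.col_sum,
    one_mul]

theorem blockMap_groupMean_congr {k l : Fin N} (h : group k = group l) (z : BlockVec N E) :
    blockMap (groupMean group p) z k = blockMap (groupMean group p) z l := by
  simp [blockMap_apply, groupMean_apply, h]

theorem blockMap_groupMean_of_const (hp : IsPerronVector group A p) {z : BlockVec N E}
    (h : ∀ k l, group k = group l → z k = z l) : blockMap (groupMean group p) z = z := by
  refine PiLp.ext fun k => ?_
  have same_group : ∀ l, groupMean group p k l • z l = groupMean group p k l • z k := fun l => by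
    rcases eq_or_ne (group l) (group k) with hl | hl
    · rw [h l k hl]
    · simp [groupMean_apply, hl]
  simp_rw [blockMap_apply, same_group, ← Finset.sum_smul, sum_groupMean hp, one_smul]

/-- The deviation of every block from the `p`-weighted mean over its group. -/
noncomputable def groupDeviation (group : Fin N → Fin G) (p : Fin N → ℝ) :
    BlockVec N E →L[ℝ] BlockVec N E :=
  ContinuousLinearMap.id ℝ _ - blockMap (groupMean group p)

theorem groupDeviation_apply (y : BlockVec N E) :
    groupDeviation group p y = y - blockMap (groupMean group p) y := rfl

theorem blockMap_groupMean_groupDeviation (hp : IsPerronVector group A p) (y : BlockVec N E) :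
    blockMap (groupMean group p) (groupDeviation group p y) = 0 := by
  rw [groupDeviation_apply, map_sub,
    blockMap_groupMean_of_const hp fun k l h => blockMap_groupMean_congr h y, sub_self]

theorem groupDeviation_combine (hA : IsCombination nbr group A) (hp : IsPerronVector group A p)
    (y : BlockVec N E) : groupDeviation group p (blockMap A.transpose y) =
      blockMap A.transpose (groupDeviation group p y) := by
  simp_rw [groupDeviation_apply, map_sub, ← blockMap_mul, groupMean_mul_transpose hA hp,
    transpose_mul_groupMean hA]

theorem eq_of_groupDeviation_eq_zero {z : BlockVec N E} (hz : groupDeviation group p z = 0)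
    {k l : Fin N} (h : group k = group l) : z k = z l := by
  rw [groupDeviation_apply, sub_eq_zero] at hz
  rw [hz]
  exact blockMap_groupMean_congr h z

/-! ### Contraction properties of the combination step -/

/-- The `p`-weighted mean square distance between the blocks that an agent combines and their
combination. -/
noncomputable def combinationVariance (A : Matrix (Fin N) (Fin N) ℝ) (p : Fin N → ℝ)
    (y : BlockVec N E) : ℝ :=
  ∑ k, p k * ∑ l, A l k * ‖y l - blockMap A.transpose y k‖ ^ 2

theorem combinationVariance_eq (hA : IsCombination nbr group A) (hp : IsPerronVector group A p)
    (hpos : ∀ k, 0 ≤ p k) (y : BlockVec N E) : combinationVariance A p y =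
      ‖sqrtScale p y‖ ^ 2 - ‖sqrtScale p (blockMap A.transpose y)‖ ^ 2 := by
  have variance : ∀ k, ∑ l, A l k * ‖y l - blockMap A.transpose y k‖ ^ 2 =
      ∑ l, A l k * ‖y l‖ ^ 2 - ‖blockMap A.transpose y k‖ ^ 2 := fun k =>
    sum_mul_norm_sub_sq (hA.col_sum k) y
  simp_rw [combinationVariance, variance, mul_sub, Finset.sum_sub_distrib,
    norm_sqrtScale_sq hpos, Finset.mul_sum]
  rw [Finset.sum_comm]
  congr 1
  refine Finset.sum_congr rfl fun l _ => ?_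
  rw [← hp.sum_mul hA l, Finset.sum_mul]
  exact Finset.sum_congr rfl fun k _ => by ring

theorem combinationVariance_nonneg (hA : IsCombination nbr group A) (hpos : ∀ k, 0 ≤ p k)
    (y : BlockVec N E) : 0 ≤ combinationVariance A p y :=
  Finset.sum_nonneg fun k _ => mul_nonneg (hpos k)
    (Finset.sum_nonneg fun l _ => mul_nonneg (hA.nonneg l k) (sq_nonneg _))

theorem combinationVariance_groupDeviation (hA : IsCombination nbr group A) (y : BlockVec N E) :
    combinationVariance A p (groupDeviation group p y) = combinationVariance A p y := by
  refine Finset.sum_congr rfl fun k _ => ?_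
  congr 1
  refine Finset.sum_congr rfl fun l _ => ?_
  rcases eq_or_ne (group l) (group k) with h | h
  · rw [groupDeviation_apply, map_sub, ← blockMap_mul A.transpose, transpose_mul_groupMean hA,
      PiLp.sub_apply, PiLp.sub_apply, blockMap_groupMean_congr h y, sub_sub_sub_cancel_right]
  · rw [hA.eq_zero h, zero_mul, zero_mul]

theorem eq_of_combinationVariance_eq_zero (hgroup : IsGrouping nbr group wo)
    (hA : IsCombination nbr group A) (hpos : ∀ k, 0 < p k) {y : BlockVec N E}
    (hy : combinationVariance A p y = 0) {k l : Fin N} (hkl : group k = group l) : y k = y l := by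
  have term_nonneg : ∀ k l, 0 ≤ A l k * ‖y l - blockMap A.transpose y k‖ ^ 2 := fun k l =>
    mul_nonneg (hA.nonneg l k) (sq_nonneg _)
  have eq_combination : ∀ l k, l ∈ nbr k → group l = group k →
      y l = blockMap A.transpose y k := by
    intro l k hl hlk
    have agent_eq_zero := (Finset.sum_eq_zero_iff_of_nonneg fun k _ => mul_nonneg (hpos k).le
      (Finset.sum_nonneg fun l _ => term_nonneg k l)).1 hy k (Finset.mem_univ k)
    have term_eq_zero := (Finset.sum_eq_zero_iff_of_nonneg fun l _ => term_nonneg k l).1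
      ((mul_eq_zero.1 agent_eq_zero).resolve_left (hpos k).ne') l (Finset.mem_univ l)
    have := (mul_eq_zero.1 term_eq_zero).resolve_left (hA.pos l k hl hlk).ne'
    exact sub_eq_zero.1 (norm_eq_zero.1 (pow_eq_zero_iff two_ne_zero |>.1 this))
  have path := hgroup.connected k l hkl
  clear hkl
  induction path with
  | refl => rfl
  | tail _ link ih =>
    rw [ih, eq_combination _ _ link.1 link.2, ← eq_combination _ _ (hgroup.self_mem _) rfl]

theorem exists_norm_sqrtScale_combine_sq_le [FiniteDimensional ℝ E]
    (hgroup : IsGrouping nbr group wo) (hA : IsCombination nbr group A)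
    (hp : IsPerronVector group A p) :
    ∃ δ, 0 < δ ∧ ∀ y : BlockVec N E, ‖sqrtScale p (blockMap A.transpose y)‖ ^ 2 ≤
      ‖sqrtScale p y‖ ^ 2 - δ * ‖groupDeviation group p y‖ ^ 2 := by
  have hpos := hp.pos hgroup hA
  have hpos' : ∀ k, 0 ≤ p k := fun k => (hpos k).le
  have variance_eq := combinationVariance_eq (E := E) hA hp hpos'
  obtain ⟨δ, hδ, hle⟩ := exists_pos_mul_norm_sq_le (E := BlockVec N E)
    (f := fun y => combinationVariance A p y + ‖blockMap (groupMean group p) y‖ ^ 2)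
    (by simp_rw [variance_eq]; fun_prop)
    (fun c x => by
      simp only [variance_eq, map_smul, norm_smul, mul_pow, Real.norm_eq_abs, sq_abs]; ring)
    (fun y hy => by
      have variance_nonneg := combinationVariance_nonneg hA hpos' y
      refine (add_nonneg variance_nonneg (sq_nonneg _)).lt_of_ne' fun h => hy ?_
      obtain ⟨variance_zero, mean_zero⟩ :=
        (add_eq_zero_iff_of_nonneg variance_nonneg (sq_nonneg _)).1 h
      rw [← blockMap_groupMean_of_const hp fun k l =>
        eq_of_combinationVariance_eq_zero hgroup hA hpos variance_zero]
      simpa using mean_zero)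
  refine ⟨δ, hδ, fun y => ?_⟩
  have h := hle (groupDeviation group p y)
  rw [combinationVariance_groupDeviation hA, blockMap_groupMean_groupDeviation hp, norm_zero,
    variance_eq] at h
  linarith

theorem exists_deviation_contraction [FiniteDimensional ℝ E] (hgroup : IsGrouping nbr group wo)
    (hA : IsCombination nbr group A) (hp : IsPerronVector group A p) :
    ∃ r, 0 ≤ r ∧ r < 1 ∧ ∀ y : BlockVec N E,
      ‖sqrtScale p (groupDeviation group p (blockMap A.transpose y))‖ ≤
        r * ‖sqrtScale p (groupDeviation group p y)‖ := by
  obtain ⟨δ, hδ, hle⟩ := exists_norm_sqrtScale_combine_sq_le (E := E) hgroup hA hp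
  set S : BlockVec N E →L[ℝ] BlockVec N E := sqrtScale p
  refine ⟨√(1 - δ / (δ + ‖S‖ ^ 2)), Real.sqrt_nonneg _, ?_, fun y => ?_⟩
  · rw [Real.sqrt_lt' one_pos, one_pow, sub_lt_self_iff]
    positivity
  set d := groupDeviation group p y with hd
  have deviation_deviation : groupDeviation group p d = d := by
    rw [groupDeviation_apply, hd, blockMap_groupMean_groupDeviation hp, sub_zero]
  have norm_le : δ / (δ + ‖S‖ ^ 2) * ‖S d‖ ^ 2 ≤ δ * ‖d‖ ^ 2 := by
    calc δ / (δ + ‖S‖ ^ 2) * ‖S d‖ ^ 2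
        ≤ δ / (δ + ‖S‖ ^ 2) * ((δ + ‖S‖ ^ 2) * ‖d‖ ^ 2) := by
          gcongr
          calc ‖S d‖ ^ 2 ≤ (‖S‖ * ‖d‖) ^ 2 := by gcongr; exact S.le_opNorm d
            _ ≤ (δ + ‖S‖ ^ 2) * ‖d‖ ^ 2 := by rw [mul_pow]; gcongr; linarith
      _ = δ * ‖d‖ ^ 2 := by field_simp
  have sq_le := hle d
  rw [deviation_deviation] at sq_le
  rw [groupDeviation_combine hA hp, ← hd]
  calc ‖S (blockMap A.transpose d)‖ ≤ √((1 - δ / (δ + ‖S‖ ^ 2)) * ‖S d‖ ^ 2) :=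
        Real.le_sqrt_of_sq_le (by linarith)
    _ = √(1 - δ / (δ + ‖S‖ ^ 2)) * ‖S d‖ := by
        rw [Real.sqrt_mul' _ (sq_nonneg _), Real.sqrt_sq (norm_nonneg _)]

theorem exists_norm_sq_le_weighted_add [FiniteDimensional ℝ E] {w : Fin N → ℝ}
    (hw : ∀ k, 0 ≤ w k) (hw' : ∀ m, ∃ k ∈ groupAgents group m, 0 < w k) :
    ∃ c, 0 < c ∧ ∀ z : BlockVec N E, c * ‖z‖ ^ 2 ≤
      ∑ k, w k * ‖z k‖ ^ 2 + ‖groupDeviation group p z‖ ^ 2 := by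
  have term_nonneg : ∀ (z : BlockVec N E), ∀ k ∈ Finset.univ, 0 ≤ w k * ‖z k‖ ^ 2 :=
    fun z k _ => mul_nonneg (hw k) (sq_nonneg _)
  refine exists_pos_mul_norm_sq_le (by fun_prop) (fun c x => ?_) fun z hz => ?_
  · simp only [map_smul, PiLp.smul_apply, norm_smul, mul_pow, Real.norm_eq_abs, sq_abs, mul_add,
      Finset.mul_sum, mul_left_comm]
  · refine (add_nonneg (Finset.sum_nonneg (term_nonneg z)) (sq_nonneg _)).lt_of_ne' fun h => hz ?_
    obtain ⟨sum_zero, deviation_zero⟩ :=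
      (add_eq_zero_iff_of_nonneg (Finset.sum_nonneg (term_nonneg z)) (sq_nonneg _)).1 h
    refine PiLp.ext fun k => ?_
    obtain ⟨j, hj, hwj⟩ := hw' (group k)
    rw [eq_of_groupDeviation_eq_zero (by simpa using deviation_zero)
      (Finset.mem_filter.1 hj).2.symm]
    have := (Finset.sum_eq_zero_iff_of_nonneg (term_nonneg z)).1 sum_zero j (Finset.mem_univ j)
    simpa [hwj.ne'] using this

theorem exists_drift_contraction [FiniteDimensional ℝ E] (hgroup : IsGrouping nbr group wo)
    (hA : IsCombination nbr group A) (hp : IsPerronVector group A p)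
    {μ lam : Fin N → ℝ} (hμ : ∀ k, 0 < μ k) (hlam : ∀ k, 0 ≤ lam k)
    (hlam' : ∀ m, ∃ k ∈ groupAgents group m, 0 < lam k) {g : BlockVec N E → BlockVec N E} {C : ℝ}
    (hC : ∀ z, ‖g z‖ ≤ C * ‖z‖) (hg : ∀ z k, inner ℝ (z k) (g z k) ≤ -(lam k * ‖z k‖ ^ 2)) :
    ∃ c, 0 < c ∧ ∀ᶠ t in 𝓝[>] (0 : ℝ), ∀ z,
      ‖sqrtScale p (blockMap A.transpose (z + t • blockMap (Matrix.diagonal μ) (g z)))‖ ≤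
        (1 - c * t) * ‖sqrtScale p z‖ := by
  have hpos := hp.pos hgroup hA
  obtain ⟨δ, hδ, combine_le⟩ := exists_norm_sqrtScale_combine_sq_le (E := E) hgroup hA hp
  obtain ⟨c, hc, coercive⟩ := exists_norm_sq_le_weighted_add (E := E) (p := p)
    (w := fun k => p k * (μ k * lam k))
    (fun k => mul_nonneg (hpos k).le (mul_nonneg (hμ k).le (hlam k)))
    (fun m => (hlam' m).imp fun k hk => ⟨hk.1, mul_pos (hpos k) (mul_pos (hμ k) hk.2)⟩)
  refine exists_contraction_of_dissipative hδ hc (fun z => ?_) combine_le (fun z => ?_) coercive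
    (C := ‖blockMap (E := E) (Matrix.diagonal μ)‖ * C)
  · rw [mul_assoc]
    exact ContinuousLinearMap.le_opNorm_of_le _ (hC z)
  · rw [inner_sqrtScale fun k => (hpos k).le, ← Finset.sum_neg_distrib]
    refine Finset.sum_le_sum fun k _ => ?_
    rw [blockMap_diagonal, real_inner_smul_right]
    linarith [mul_le_mul_of_nonneg_left (hg z k) (mul_pos (hpos k) (hμ k)).le]

end Network

/-! ### Gradients and Hessians of the costs -/

theorem mul_norm_sq_le_inner_sub_of_fderiv {F : Type*} [NormedAddCommGroup F]
    [InnerProductSpace ℝ F] {f : F → F} (hf : Differentiable ℝ f) {a : ℝ}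
    (ha : ∀ x v, a * ‖v‖ ^ 2 ≤ inner ℝ v (fderiv ℝ f x v)) (x y : F) :
    a * ‖y - x‖ ^ 2 ≤ inner ℝ (y - x) (f y - f x) := by
  obtain ⟨ξ, -, mean_value⟩ := domain_mvt (f := fun z => inner ℝ (y - x) (f z))
    (fun z _ => ((innerSL ℝ (y - x)).hasFDerivAt.comp z (hf z).hasFDerivAt).hasFDerivWithinAt)
    convex_univ (Set.mem_univ x) (Set.mem_univ y)
  rw [inner_sub_right, mean_value]
  exact ha ξ (y - x)

theorem norm_sub_sub_fderiv_le {E F : Type*} [NormedAddCommGroup E] [NormedSpace ℝ E]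
    [NormedAddCommGroup F] [NormedSpace ℝ F] {f : E → F} (hf : Differentiable ℝ f) {κ : ℝ}
    (hκ : 0 ≤ κ) (hlip : ∀ x y, ‖fderiv ℝ f y - fderiv ℝ f x‖ ≤ κ * ‖y - x‖) (x y : E) :
    ‖f y - f x - fderiv ℝ f x (y - x)‖ ≤ κ * ‖y - x‖ ^ 2 := by
  rw [sq, ← mul_assoc]
  refine (convex_closedBall x ‖y - x‖).norm_image_sub_le_of_norm_fderiv_le' (fun z _ => hf z)
    (fun z hz => (hlip x z).trans ?_) (Metric.mem_closedBall_self (norm_nonneg _)) ?_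
  · gcongr
    exact mem_closedBall_iff_norm.1 hz
  · exact mem_closedBall_iff_norm.2 le_rfl

theorem l2_opNorm_submatrix_le {m n : Type*} [Fintype m] [DecidableEq m] [Fintype n]
    [DecidableEq n] (A : Matrix n n ℝ) {e : m → n} (he : Function.Injective e) :
    ‖A.submatrix e e‖ ≤ ‖A‖ := by
  set B : Matrix n m ℝ := (1 : Matrix n n ℝ).submatrix id e with hB
  have isometry : B.conjTranspose * B = 1 := by
    rw [hB, Matrix.conjTranspose_submatrix, Matrix.conjTranspose_one,
      ← Matrix.submatrix_mul _ _ _ _ _ Function.bijective_id, one_mul, Matrix.submatrix_one _ he]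
  have norm_le_one : ‖B‖ ≤ 1 := by
    have h := Matrix.l2_opNorm_conjTranspose_mul_self B
    rw [isometry] at h
    have norm_one_le : ‖(1 : Matrix m m ℝ)‖ ≤ 1 := by
      rw [Matrix.cstar_norm_def, map_one]
      exact ContinuousLinearMap.norm_id_le
    nlinarith [norm_nonneg B]
  have compress : A.submatrix e e = B.conjTranspose * A * B := by
    ext i j
    simp [hB, Matrix.mul_apply, Matrix.one_apply]
  calc ‖A.submatrix e e‖ ≤ ‖B.conjTranspose‖ * ‖A‖ * ‖B‖ := by
        rw [compress]
        exact (Matrix.l2_opNorm_mul _ _).trans (by gcongr; exact Matrix.l2_opNorm_mul _ _)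
    _ ≤ 1 * ‖A‖ * 1 := by rw [Matrix.l2_opNorm_conjTranspose]; gcongr
    _ = ‖A‖ := by ring

section PosSemidef

variable {n : Type*} [Fintype n] [DecidableEq n] {A : Matrix n n ℝ} {c : ℝ}

theorem inner_toEuclideanCLM_nonneg (hA : A.PosSemidef) (v : EuclideanSpace ℝ n) :
    0 ≤ inner ℝ v (Matrix.toEuclideanCLM (𝕜 := ℝ) A v) := by
  simpa [Matrix.inner_toEuclideanCLM] using hA.dotProduct_mulVec_nonneg v.ofLp

theorem mul_norm_sq_le_inner_toEuclideanCLM (h : (A - c • (1 : Matrix n n ℝ)).PosSemidef)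
    (v : EuclideanSpace ℝ n) :
    c * ‖v‖ ^ 2 ≤ inner ℝ v (Matrix.toEuclideanCLM (𝕜 := ℝ) A v) := by
  have := inner_toEuclideanCLM_nonneg h v
  simpa [inner_sub_right, real_inner_smul_right] using this

theorem inner_toEuclideanCLM_le_mul_norm_sq (h : (c • (1 : Matrix n n ℝ) - A).PosSemidef)
    (v : EuclideanSpace ℝ n) :
    inner ℝ v (Matrix.toEuclideanCLM (𝕜 := ℝ) A v) ≤ c * ‖v‖ ^ 2 := by
  have := inner_toEuclideanCLM_nonneg h v
  simpa [inner_sub_right, real_inner_smul_right] using this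

theorem l2_opNorm_le_of_posSemidef_sub (hA : A.PosSemidef) (hc : 0 ≤ c)
    (h : (c • (1 : Matrix n n ℝ) - A).PosSemidef) : ‖A‖ ≤ c := by
  have symmetric : (Matrix.toEuclideanCLM (𝕜 := ℝ) A).IsSymmetric :=
    Matrix.isSymmetric_toEuclideanLin_iff.2 hA.1
  rw [Matrix.cstar_norm_def, ContinuousLinearMap.norm_eq_iSup_rayleighQuotient _ symmetric]
  refine ciSup_le fun v => ?_
  rw [ContinuousLinearMap.rayleighQuotient, ContinuousLinearMap.reApplyInnerSelf_apply,
    real_inner_comm, RCLike.re_to_real,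
    abs_of_nonneg (div_nonneg (inner_toEuclideanCLM_nonneg hA v) (sq_nonneg _))]
  exact div_le_of_le_mul₀ (sq_nonneg _) hc (inner_toEuclideanCLM_le_mul_norm_sq h v)

end PosSemidef

theorem fderiv_gradient_eq {M : ℕ} (f : EuclideanSpace ℝ (Fin M) → ℝ)
    (x : EuclideanSpace ℝ (Fin M)) :
    fderiv ℝ (gradient f) x = Matrix.toEuclideanCLM (𝕜 := ℝ) (hessianMatrix f x) := by
  refine ContinuousLinearMap.ext fun v => PiLp.ext fun a => ?_
  have expand := (EuclideanSpace.basisFun (Fin M) ℝ).sum_repr v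
  rw [Matrix.ofLp_toEuclideanCLM]
  conv_lhs => rw [← expand]
  simp [Matrix.mulVec, dotProduct, hessianMatrix, mul_comm]

section Cost

variable {N M G : ℕ} {group : Fin N → Fin G} {J : Fin N → EuclideanSpace ℝ (Fin M) → ℝ}
  {wo : NetVec N M}

theorem norm_hessianMatrix_sub_le {κ : ℝ}
    (h : ∀ W₁ W₂ : NetVec N M, ‖networkHessian J W₁ - networkHessian J W₂‖ ≤ κ * ‖W₁ - W₂‖)
    (k : Fin N) (x y : EuclideanSpace ℝ (Fin M)) :
    ‖hessianMatrix (J k) y - hessianMatrix (J k) x‖ ≤ κ * ‖y - x‖ := by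
  set W : EuclideanSpace ℝ (Fin M) → NetVec N M := fun x => PiLp.single 2 k x
  have block_eq : hessianMatrix (J k) y - hessianMatrix (J k) x =
      (networkHessian J (W y) - networkHessian J (W x)).submatrix (Prod.mk k) (Prod.mk k) := by
    ext a b
    simp [networkHessian, W]
  calc ‖hessianMatrix (J k) y - hessianMatrix (J k) x‖
      ≤ ‖networkHessian J (W y) - networkHessian J (W x)‖ := by
        rw [block_eq]
        exact l2_opNorm_submatrix_le _ (Prod.mk_right_injective k)
    _ ≤ κ * ‖W y - W x‖ := h _ _
    _ = κ * ‖y - x‖ := by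
        simp only [W]
        rw [← PiLp.single_sub, PiLp.norm_single]

/-- The gradients at `wo - z`, as a function of the network error `z`. -/
noncomputable def gradError (J : Fin N → EuclideanSpace ℝ (Fin M) → ℝ) (wo z : NetVec N M) :
    NetVec N M :=
  WithLp.toLp 2 fun k => gradient (J k) (wo k - z k)

namespace CostAssumption

theorem posSemidef_hessianMatrix (h : CostAssumption group J wo) (k : Fin N)
    (w : EuclideanSpace ℝ (Fin M)) : (hessianMatrix (J k) w).PosSemidef := by
  obtain ⟨lamL, lamU, bounds, -⟩ := h.hessian_bounds
  simpa using ((bounds k).2.2 w).1.add (Matrix.PosSemidef.one.smul (bounds k).1)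

theorem exists_posDef_hessianMatrix (h : CostAssumption group J wo) (m : Fin G) :
    ∃ k ∈ groupAgents group m, ∀ w, (hessianMatrix (J k) w).PosDef := by
  obtain ⟨lamL, lamU, bounds, pos⟩ := h.hessian_bounds
  obtain ⟨k, hk, hlam⟩ := pos m
  refine ⟨k, hk, fun w => ?_⟩
  simpa using Matrix.PosDef.posSemidef_add ((bounds k).2.2 w).1 (Matrix.PosDef.one.smul hlam)

theorem gradError_apply (h : CostAssumption group J wo) (z : NetVec N M) (k : Fin N) :
    gradError J wo z k = gradient (J k) (wo k - z k) - gradient (J k) (wo k) := by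
  have gradient_minimizer : gradient (J k) (wo k) = 0 := by
    rw [gradient, ((h.minimizer k).isLocalMin univ_mem).fderiv_eq_zero, map_zero]
  rw [gradient_minimizer, sub_zero, gradError]

theorem continuous_gradError (h : CostAssumption group J wo) : Continuous (gradError J wo) := by
  refine (PiLp.continuous_toLp 2 _).comp (continuous_pi fun k => ?_)
  exact (h.twice_differentiable k).continuous.comp (by fun_prop)

theorem exists_inner_gradError_le (h : CostAssumption group J wo) :
    ∃ lam : Fin N → ℝ, (∀ k, 0 ≤ lam k) ∧ (∀ m, ∃ k ∈ groupAgents group m, 0 < lam k) ∧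
      ∀ z k, inner ℝ (z k) (gradError J wo z k) ≤ -(lam k * ‖z k‖ ^ 2) := by
  obtain ⟨lamL, lamU, bounds, pos⟩ := h.hessian_bounds
  refine ⟨lamL, fun k => (bounds k).1, pos, fun z k => ?_⟩
  have := mul_norm_sq_le_inner_sub_of_fderiv (h.twice_differentiable k) (fun w v => by
    rw [fderiv_gradient_eq]
    exact mul_norm_sq_le_inner_toEuclideanCLM ((bounds k).2.2 w).1 v) (wo k) (wo k - z k)
  rw [← h.gradError_apply, sub_sub_cancel_left, norm_neg, inner_neg_left] at this
  linarith

theorem exists_norm_gradError_le (h : CostAssumption group J wo) :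
    ∃ C, 0 ≤ C ∧ ∀ z, ‖gradError J wo z‖ ≤ C * ‖z‖ := by
  obtain ⟨lamL, lamU, bounds, -⟩ := h.hessian_bounds
  have lamU_nonneg : ∀ k, 0 ≤ lamU k := fun k => (bounds k).1.trans (bounds k).2.1
  have block_le : ∀ z k, ‖gradError J wo z k‖ ≤ ‖WithLp.toLp 2 lamU‖ * ‖z k‖ := fun z k => by
    have := (convex_univ (𝕜 := ℝ)).norm_image_sub_le_of_norm_fderiv_le
      (fun w _ => h.twice_differentiable k w) (C := lamU k) (fun w _ => by
        rw [fderiv_gradient_eq, Matrix.l2_opNorm_toEuclideanCLM]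
        exact l2_opNorm_le_of_posSemidef_sub (h.posSemidef_hessianMatrix k w) (lamU_nonneg k)
          ((bounds k).2.2 w).2) (Set.mem_univ (wo k)) (Set.mem_univ (wo k - z k))
    rw [← h.gradError_apply, sub_sub_cancel_left, norm_neg] at this
    refine this.trans ?_
    gcongr
    exact (Real.le_norm_self _).trans (PiLp.norm_apply_le (WithLp.toLp 2 lamU) k)
  refine ⟨‖WithLp.toLp 2 lamU‖, norm_nonneg _, fun z => ?_⟩
  refine le_of_sq_le_sq ?_ (by positivity)
  rw [mul_pow, PiLp.norm_sq_eq_of_L2, PiLp.norm_sq_eq_of_L2 _ z, Finset.mul_sum]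
  refine Finset.sum_le_sum fun k _ => ?_
  rw [← mul_pow]
  exact pow_le_pow_left₀ (norm_nonneg _) (block_le z k) 2

theorem exists_norm_gradError_add_le (h : CostAssumption group J wo) :
    ∃ κ, 0 ≤ κ ∧ ∀ z k, ‖gradError J wo z k +
      Matrix.toEuclideanCLM (𝕜 := ℝ) (hessianMatrix (J k) (wo k)) (z k)‖ ≤ κ * ‖z k‖ ^ 2 := by
  obtain ⟨κ, hκ, lipschitz⟩ := h.hessian_lipschitz
  refine ⟨κ, hκ, fun z k => ?_⟩
  have := norm_sub_sub_fderiv_le (h.twice_differentiable k) hκ (fun x y => by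
    rw [fderiv_gradient_eq, fderiv_gradient_eq, ← map_sub, Matrix.l2_opNorm_toEuclideanCLM]
    exact norm_hessianMatrix_sub_le lipschitz k x y) (wo k) (wo k - z k)
  rwa [← h.gradError_apply, sub_sub_cancel_left, norm_neg, map_neg, sub_neg_eq_add,
    fderiv_gradient_eq] at this

end CostAssumption

end Cost

/-! ### Noise covariance -/

theorem abs_dotProduct_mulVec_le {n : Type*} [Fintype n] [DecidableEq n] (A : Matrix n n ℝ)
    (v w : EuclideanSpace ℝ n) : |v.ofLp ⬝ᵥ A.mulVec w.ofLp| ≤ ‖A‖ * (‖v‖ * ‖w‖) :=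
  calc |v.ofLp ⬝ᵥ A.mulVec w.ofLp| = |inner ℝ v (Matrix.toEuclideanCLM (𝕜 := ℝ) A w)| := by
        rw [Matrix.inner_toEuclideanCLM]
    _ ≤ ‖v‖ * (‖A‖ * ‖w‖) := by
        refine (abs_real_inner_le_norm _ _).trans ?_
        gcongr
        exact ContinuousLinearMap.le_opNorm _ _
    _ = ‖A‖ * (‖v‖ * ‖w‖) := by ring

theorem abs_netVec_apply_mul_le {N M : ℕ} (v : NetVec N M) (x y : Fin N × Fin M) :
    |v x.1 x.2 * v y.1 y.2| ≤ 1 + ‖v‖ ^ 4 := by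
  have hentry (x : Fin N × Fin M) : |v x.1 x.2| ≤ ‖v‖ :=
    (PiLp.norm_apply_le (v x.1) x.2).trans (PiLp.norm_apply_le v x.1)
  rw [abs_mul]
  calc |v x.1 x.2| * |v y.1 y.2| ≤ ‖v‖ * ‖v‖ := by gcongr <;> apply hentry
    _ ≤ 1 + ‖v‖ ^ 4 := by nlinarith [sq_nonneg (‖v‖ ^ 2 - 1), sq_nonneg (‖v‖ ^ 2)]

section Noise

variable {N M : ℕ} {Ω : Type*} [mΩ : MeasurableSpace Ω] {P : Measure Ω}

theorem integrable_dotProduct_mulVec {n : Type*} [Fintype n] {F : Ω → Matrix n n ℝ}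
    (hF : ∀ x y, Integrable (fun ω => F ω x y) P) (c d : n → ℝ) :
    Integrable (fun ω => c ⬝ᵥ (F ω).mulVec d) P :=
  integrable_finsetSum _ fun x _ =>
    (integrable_finsetSum _ fun y _ => (hF x y).mul_const _).const_mul _

theorem integral_dotProduct_mulVec {n : Type*} [Fintype n] {F : Ω → Matrix n n ℝ}
    (hF : ∀ x y, Integrable (fun ω => F ω x y) P) (c d : n → ℝ) :
    ∫ ω, c ⬝ᵥ (F ω).mulVec d ∂P = c ⬝ᵥ (Matrix.of fun x y => ∫ ω, F ω x y ∂P).mulVec d := by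
  simp only [dotProduct, Matrix.mulVec, Matrix.of_apply]
  rw [integral_finsetSum _ fun x _ =>
    (integrable_finsetSum _ fun y _ => (hF x y).mul_const _).const_mul _]
  simp only [integral_const_mul, ← integral_mul_const]
  exact Finset.sum_congr rfl fun x _ => by
    rw [integral_finsetSum _ fun y _ => (hF x y).mul_const _]

theorem memLp_netVec_apply {f : Ω → NetVec N M} {q : ℝ≥0∞} (hf : MemLp f q P)
    (x : Fin N × Fin M) : MemLp (fun ω => f ω x.1 x.2) q P := by
  have hcont : Continuous fun v : NetVec N M => v x.1 x.2 := by fun_prop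
  exact hf.of_le (hcont.comp_aestronglyMeasurable hf.1) (ae_of_all _ fun ω =>
    (PiLp.norm_apply_le (f ω x.1) x.2).trans (PiLp.norm_apply_le (f ω) x.1))

theorem integrable_netVec_apply_mul {f : Ω → NetVec N M} (hf : MemLp f 2 P)
    (x y : Fin N × Fin M) : Integrable (fun ω => f ω x.1 x.2 * f ω y.1 y.2) P :=
  (memLp_netVec_apply hf x).integrable_mul (memLp_netVec_apply hf y)

theorem integral_norm_rpow_le_lpNorm_rpow [IsProbabilityMeasure P] {E : Type*}
    [NormedAddCommGroup E] {f : Ω → E} {q : ℝ≥0∞} {γ : ℝ} (hγ : 0 < γ)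
    (hγq : ENNReal.ofReal γ ≤ q) (hf : MemLp f q P) :
    ∫ ω, ‖f ω‖ ^ γ ∂P ≤ lpNorm f q P ^ γ := by
  have hγ_norm : lpNorm f (ENNReal.ofReal γ) P ^ γ = ∫ ω, ‖f ω‖ ^ γ ∂P := by
    rw [lpNorm_eq_integral_norm_rpow_toReal (by simpa) ENNReal.ofReal_ne_top hf.1,
      ENNReal.toReal_ofReal hγ.le, Real.rpow_inv_rpow _ hγ.ne']
    exact integral_nonneg fun _ => Real.rpow_nonneg (norm_nonneg _) γ
  rw [← hγ_norm]
  exact Real.rpow_le_rpow lpNorm_nonneg (lpNorm_le_lpNorm_of_exponent_le hγq hf) hγ.le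

theorem integrable_norm_rpow [IsFiniteMeasure P] {E : Type*}
    [NormedAddCommGroup E] {f : Ω → E} {q : ℝ≥0∞} {γ : ℝ} (hγ : 0 < γ)
    (hγq : ENNReal.ofReal γ ≤ q) (hf : MemLp f q P) :
    Integrable (fun ω => ‖f ω‖ ^ γ) P := by
  simpa [ENNReal.toReal_ofReal hγ.le] using
    (hf.mono_exponent hγq).integrable_norm_rpow (by simpa) ENNReal.ofReal_ne_top

variable {ℱ : Filtration ℕ mΩ}
  {J : Fin N → EuclideanSpace ℝ (Fin M) → ℝ} {wo : NetVec N M}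
  {gradHat : ℕ → Fin N → Ω → EuclideanSpace ℝ (Fin M) → EuclideanSpace ℝ (Fin M)}
  {Rs : NetMat N M}

theorem integrable_noiseCov (i : ℕ) (W : Ω → NetVec N M) (x y : Fin N × Fin M) :
    Integrable (fun ω => noiseCov P ℱ J gradHat i W ω x y) P :=
  integrable_condExp

variable [IsProbabilityMeasure P]

theorem integral_dotProduct_noiseCov {i : ℕ} {W : Ω → NetVec N M}
    (hs : MemLp (fun ω => gradNoise J gradHat i ω (W ω)) 2 P) (c : Fin N × Fin M → ℝ) :
    ∫ ω, (∑ x, c x * gradNoise J gradHat i ω (W ω) x.1 x.2) ^ 2 ∂P =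
      ∫ ω, c ⬝ᵥ (noiseCov P ℱ J gradHat i W ω).mulVec c ∂P := by
  have hsq (v : Fin N × Fin M → ℝ) :
      (∑ x, c x * v x) ^ 2 = c ⬝ᵥ (Matrix.of fun x y => v x * v y).mulVec c := by
    simp only [dotProduct, Matrix.mulVec, Matrix.of_apply, Finset.mul_sum]
    rw [sq, Finset.sum_mul_sum]
    exact Finset.sum_congr rfl fun x _ => Finset.sum_congr rfl fun y _ => by ring
  have hcov (x y : Fin N × Fin M) : ∫ ω, noiseCov P ℱ J gradHat i W ω x y ∂P = ∫ ω,
      gradNoise J gradHat i ω (W ω) x.1 x.2 * gradNoise J gradHat i ω (W ω) y.1 y.2 ∂P :=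
    integral_condExp (ℱ.le i)
  rw [integral_dotProduct_mulVec (integrable_noiseCov i W)]
  simp only [hsq fun x => gradNoise J gradHat i _ (W _) x.1 x.2, hcov]
  exact integral_dotProduct_mulVec (integrable_netVec_apply_mul hs) c c

namespace NoiseAssumption

theorem exists_abs_noiseCov_le (h : NoiseAssumption P ℱ J wo gradHat Rs) :
    ∃ K, ∀ i x y, ∀ᵐ ω ∂P, |noiseCov P ℱ J gradHat i (fun _ => wo) ω x y| ≤ K := by
  obtain ⟨α, σ, -, -, hσ⟩ := h.fourth_moment
  refine ⟨1 + σ ^ 4, fun i x y => ?_⟩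
  have hwo : StronglyMeasurable[ℱ i] fun _ : Ω => wo := stronglyMeasurable_const
  have hs := (h.measurable i _ hwo (memLp_const wo)).2
  have hs_four : Integrable (fun ω => ‖gradNoise J gradHat i ω wo‖ ^ 4) P :=
    hs.integrable_norm_pow (by norm_num)
  have hs_two := integrable_netVec_apply_mul (hs.mono_exponent (by norm_num)) x y
  have hadd := condExp_add (integrable_const (1 : ℝ)) hs_four (ℱ i)
  rw [condExp_const (ℱ.le i)] at hadd
  filter_upwards [norm_condExp_le (m := ℱ i) (μ := P)
      fun ω => gradNoise J gradHat i ω wo x.1 x.2 * gradNoise J gradHat i ω wo y.1 y.2,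
    condExp_mono (m := ℱ i) hs_two.norm ((integrable_const (1 : ℝ)).add hs_four)
      (ae_of_all _ fun ω => abs_netVec_apply_mul_le (gradNoise J gradHat i ω wo) x y),
    hadd, hσ i _ hwo (memLp_const wo)] with ω hnorm hmono hadd hfour
  simp only [sub_self, norm_zero, ne_eq, OfNat.ofNat_ne_zero, not_false_eq_true, zero_pow,
    mul_zero, zero_add] at hfour
  rw [hadd, Pi.add_apply] at hmono
  exact hnorm.trans (hmono.trans (by gcongr))

theorem tendsto_integral_noiseCov (h : NoiseAssumption P ℱ J wo gradHat Rs)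
    (x y : Fin N × Fin M) :
    Tendsto (fun i => ∫ ω, noiseCov P ℱ J gradHat i (fun _ => wo) ω x y ∂P) atTop
      (𝓝 (Rs x y)) := by
  obtain ⟨K, hK⟩ := h.exists_abs_noiseCov_le
  suffices Tendsto (fun i => ∫ ω, noiseCov P ℱ J gradHat i (fun _ => wo) ω x y ∂P) atTop
      (𝓝 (∫ _, Rs x y ∂P)) by simpa
  refine tendsto_integral_of_dominated_convergence (fun _ => K)
    (fun i => (integrable_noiseCov i _ x y).1) (integrable_const K) (fun i => hK i x y) ?_
  filter_upwards [h.covariance_limit] with ω hω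
  exact ((continuous_apply_apply x y).tendsto Rs).comp hω

theorem tendsto_integral_dotProduct_noiseCov (h : NoiseAssumption P ℱ J wo gradHat Rs)
    (c : Fin N × Fin M → ℝ) :
    Tendsto (fun i => ∫ ω, c ⬝ᵥ (noiseCov P ℱ J gradHat i (fun _ => wo) ω).mulVec c ∂P) atTop
      (𝓝 (c ⬝ᵥ Rs.mulVec c)) := by
  simp only [integral_dotProduct_mulVec (integrable_noiseCov _ _)]
  exact tendsto_finsetSum _ fun x _ => (tendsto_finsetSum _ fun y _ =>
    (h.tendsto_integral_noiseCov x y).mul_const _).const_mul _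

theorem exists_abs_integral_dotProduct_noiseCov_sub_le (h : NoiseAssumption P ℱ J wo gradHat Rs)
    (c : Fin N × Fin M → ℝ) :
    ∃ C γ : ℝ, 0 < γ ∧ ∀ (i : ℕ) (W : Ω → NetVec N M), StronglyMeasurable[ℱ i] W → MemLp W 4 P →
      |∫ ω, c ⬝ᵥ (noiseCov P ℱ J gradHat i W ω).mulVec c ∂P -
        ∫ ω, c ⬝ᵥ (noiseCov P ℱ J gradHat i (fun _ => wo) ω).mulVec c ∂P| ≤
      C * lpNorm (fun ω => wo - W ω) 4 P ^ γ := by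
  obtain ⟨κ, γ, hκ, hγ, hγ4, hlip⟩ := h.covariance_lipschitz
  set C := κ * (‖(WithLp.toLp 2 c : EuclideanSpace ℝ (Fin N × Fin M))‖ *
    ‖(WithLp.toLp 2 c : EuclideanSpace ℝ (Fin N × Fin M))‖) with hC
  refine ⟨C, γ, hγ, fun i W hW hW4 => ?_⟩
  have hγ4' : ENNReal.ofReal γ ≤ 4 := by simpa using ENNReal.ofReal_le_ofReal hγ4
  have hz : MemLp (fun ω => wo - W ω) 4 P := (memLp_const wo).sub hW4
  rw [← integral_sub (integrable_dotProduct_mulVec (integrable_noiseCov i _) c c)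
    (integrable_dotProduct_mulVec (integrable_noiseCov i _) c c)]
  calc _ ≤ ∫ ω, C * ‖wo - W ω‖ ^ γ ∂P := by
        refine norm_integral_le_of_norm_le (G := ℝ)
          ((integrable_norm_rpow hγ hγ4' hz).const_mul C) ?_
        filter_upwards [hlip i W hW hW4] with ω hω
        rw [← dotProduct_sub, ← Matrix.sub_mulVec, hC, mul_right_comm]
        refine (abs_dotProduct_mulVec_le _ (WithLp.toLp 2 c) (WithLp.toLp 2 c)).trans ?_
        rw [norm_sub_rev]
        gcongr
    _ ≤ C * lpNorm (fun ω => wo - W ω) 4 P ^ γ := by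
        rw [integral_const_mul]
        gcongr
        exact integral_norm_rpow_le_lpNorm_rpow hγ hγ4' hz

theorem tendsto_integral_sq_gradNoise (h : NoiseAssumption P ℱ J wo gradHat Rs)
    {W : ℝ × ℕ → Ω → NetVec N M} (hW : ∀ x, StronglyMeasurable[ℱ x.2] (W x))
    (hW4 : ∀ x, MemLp (W x) 4 P)
    (hlim : Tendsto (fun x => lpNorm (fun ω => wo - W x ω) 4 P) steadyState (𝓝 0))
    (c : Fin N × Fin M → ℝ) :
    Tendsto (fun x => ∫ ω, (∑ y, c y * gradNoise J gradHat x.2 ω (W x ω) y.1 y.2) ^ 2 ∂P)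
      steadyState (𝓝 (c ⬝ᵥ Rs.mulVec c)) := by
  obtain ⟨C, γ, hγ, hC⟩ := h.exists_abs_integral_dotProduct_noiseCov_sub_le c
  have hpow : Tendsto (fun x => C * lpNorm (fun ω => wo - W x ω) 4 P ^ γ) steadyState (𝓝 0) := by
    simpa [Real.zero_rpow hγ.ne'] using
      (hlim.rpow_const (p := γ) (Or.inr hγ.le)).const_mul C
  have hcov (x : ℝ × ℕ) :
      ∫ ω, (∑ y, c y * gradNoise J gradHat x.2 ω (W x ω) y.1 y.2) ^ 2 ∂P =
        ∫ ω, c ⬝ᵥ (noiseCov P ℱ J gradHat x.2 (W x) ω).mulVec c ∂P :=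
    integral_dotProduct_noiseCov
      ((h.measurable x.2 (W x) (hW x) (hW4 x)).2.mono_exponent (by norm_num)) c
  simp only [hcov]
  refine tendsto_of_tendsto_of_dist
    ((h.tendsto_integral_dotProduct_noiseCov c).comp tendsto_snd_steadyState) ?_
  refine squeeze_zero (fun _ => dist_nonneg) (fun x => ?_) hpow
  rw [dist_comm, Real.dist_eq]
  exact hC x.2 (W x) (hW x) (hW4 x)

end NoiseAssumption

end Noise

/-! ### The diffusion recursion -/

section Diffusion

variable {N M G : ℕ} {Ω : Type*} {nbr : Fin N → Finset (Fin N)} {group : Fin N → Fin G}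
  {J : Fin N → EuclideanSpace ℝ (Fin M) → ℝ} {wo : NetVec N M} {A : Matrix (Fin N) (Fin N) ℝ}
  {gradHat : ℕ → Fin N → Ω → EuclideanSpace ℝ (Fin M) → EuclideanSpace ℝ (Fin M)}
  {Rs : NetMat N M} {p μ : Fin N → ℝ}

/-- The error `wo - W_i` of the network estimate available before iteration `i`. -/
noncomputable def networkError (nbr : Fin N → Finset (Fin N)) (group : Fin N → Fin G)
    (A : Matrix (Fin N) (Fin N) ℝ)
    (gradHat : ℕ → Fin N → Ω → EuclideanSpace ℝ (Fin M) → EuclideanSpace ℝ (Fin M))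
    (wo : NetVec N M) (μ : Fin N → ℝ) (i : ℕ) (ω : Ω) : NetVec N M :=
  wo - diffusion nbr group A gradHat μ i ω

theorem IsCombination.sum_nbr_inter_groupAgents (hA : IsCombination nbr group A) {E : Type*}
    [AddCommGroup E] [Module ℝ E] (k : Fin N) (y : Fin N → E) :
    ∑ l ∈ nbr k ∩ groupAgents group (group k), A l k • y l = ∑ l, A l k • y l := by
  refine Finset.sum_subset (Finset.subset_univ _) fun l _ hl => ?_
  rw [hA.zero l k fun h => hl (by simp [groupAgents, h.1, h.2]), zero_smul]

theorem blockMap_transpose_minimizer (hgroup : IsGrouping nbr group wo)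
    (hA : IsCombination nbr group A) : blockMap A.transpose wo = wo := by
  refine PiLp.ext fun k => ?_
  calc ∑ l, A l k • wo l = ∑ l, A l k • wo k := by
        refine Finset.sum_congr rfl fun l _ => ?_
        by_cases h : group l = group k
        · rw [hgroup.same_cluster l k h]
        · rw [hA.eq_zero h, zero_smul, zero_smul]
    _ = wo k := by rw [← Finset.sum_smul, hA.col_sum, one_smul]

theorem diffusion_succ (hA : IsCombination nbr group A) (J : Fin N → EuclideanSpace ℝ (Fin M) → ℝ)
    (wo : NetVec N M) (i : ℕ) (ω : Ω) :
    diffusion nbr group A gradHat μ (i + 1) ω =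
      blockMap A.transpose (diffusion nbr group A gradHat μ i ω - blockMap (Matrix.diagonal μ)
        (gradError J wo (networkError nbr group A gradHat wo μ i ω) +
          gradNoise J gradHat i ω (diffusion nbr group A gradHat μ i ω))) := by
  refine PiLp.ext fun k => (hA.sum_nbr_inter_groupAgents k _).trans ?_
  refine Finset.sum_congr rfl fun l _ => ?_
  rw [PiLp.sub_apply, blockMap_diagonal, PiLp.add_apply, Matrix.transpose_apply]
  simp only [gradError, gradNoise, networkError, PiLp.sub_apply, sub_sub_cancel,
    add_sub_cancel]

theorem networkError_smul_succ (hgroup : IsGrouping nbr group wo) (hA : IsCombination nbr group A)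
    (J : Fin N → EuclideanSpace ℝ (Fin M) → ℝ) (t : ℝ) (i : ℕ) (ω : Ω) :
    networkError nbr group A gradHat wo (t • μ) (i + 1) ω =
      blockMap A.transpose (networkError nbr group A gradHat wo (t • μ) i ω +
        t • (blockMap (Matrix.diagonal μ)
            (gradError J wo (networkError nbr group A gradHat wo (t • μ) i ω)) +
          blockMap (Matrix.diagonal μ)
            (gradNoise J gradHat i ω (diffusion nbr group A gradHat (t • μ) i ω)))) := by
  have diagonal_smul (v : NetVec N M) :
      blockMap (Matrix.diagonal (t • μ)) v = t • blockMap (Matrix.diagonal μ) v :=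
    PiLp.ext fun k => by simp only [blockMap_diagonal, PiLp.smul_apply, Pi.smul_apply, smul_assoc]
  rw [← map_add, ← diagonal_smul]
  nth_rw 1 [networkError]
  rw [diffusion_succ hA J wo]
  nth_rw 1 [← blockMap_transpose_minimizer hgroup hA]
  rw [← map_sub, ← sub_add, networkError]

variable [mΩ : MeasurableSpace Ω] {P : Measure Ω} [IsProbabilityMeasure P] {ℱ : Filtration ℕ mΩ}

theorem diffusion_stronglyMeasurable_memLp (hA : IsCombination nbr group A)
    (hcost : CostAssumption group J wo) (hnoise : NoiseAssumption P ℱ J wo gradHat Rs)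
    (μ : Fin N → ℝ) (i : ℕ) :
    StronglyMeasurable[ℱ i] (diffusion nbr group A gradHat μ i) ∧
      MemLp (diffusion nbr group A gradHat μ i) 4 P := by
  induction i with
  | zero => exact ⟨stronglyMeasurable_const, memLp_const 0⟩
  | succ i ih =>
    obtain ⟨C, -, hC⟩ := hcost.exists_norm_gradError_le
    obtain ⟨noise_measurable, noise_memLp⟩ := hnoise.measurable i _ ih.1 ih.2
    have error_memLp : MemLp (networkError nbr group A gradHat wo μ i) 4 P :=
      (memLp_const wo).sub ih.2
    have grad_measurable : StronglyMeasurable[ℱ i]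
        fun ω => gradError J wo (networkError nbr group A gradHat wo μ i ω) :=
      hcost.continuous_gradError.comp_stronglyMeasurable (stronglyMeasurable_const.sub ih.1)
    have grad_memLp :
        MemLp (fun ω => gradError J wo (networkError nbr group A gradHat wo μ i ω)) 4 P :=
      error_memLp.of_le_mul (grad_measurable.mono (ℱ.le i)).aestronglyMeasurable
        (ae_of_all _ fun ω => hC _)
    rw [funext (diffusion_succ hA J wo i)]
    constructor
    · have hle := ℱ.mono i.le_succ
      exact (blockMap A.transpose).continuous.comp_stronglyMeasurable
        ((ih.1.mono hle).sub ((blockMap (Matrix.diagonal μ)).continuous.comp_stronglyMeasurable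
          ((grad_measurable.mono hle).add noise_measurable)))
    · exact (blockMap A.transpose).comp_memLp'
        (ih.2.sub ((blockMap (Matrix.diagonal μ)).comp_memLp' (grad_memLp.add noise_memLp)))

theorem memLp_networkError (hA : IsCombination nbr group A) (hcost : CostAssumption group J wo)
    (hnoise : NoiseAssumption P ℱ J wo gradHat Rs) (μ : Fin N → ℝ) (i : ℕ) :
    MemLp (networkError nbr group A gradHat wo μ i) 4 P :=
  (memLp_const wo).sub (diffusion_stronglyMeasurable_memLp hA hcost hnoise μ i).2

theorem NoiseAssumption.exists_integral_norm_gradNoise_pow_four_le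
    (h : NoiseAssumption P ℱ J wo gradHat Rs) : ∃ K, 0 ≤ K ∧ ∀ (i : ℕ) (W : Ω → NetVec N M),
    StronglyMeasurable[ℱ i] W → MemLp W 4 P →
    ∫ ω, ‖gradNoise J gradHat i ω (W ω)‖ ^ 4 ∂P ≤ K * (∫ ω, ‖wo - W ω‖ ^ 4 ∂P + 1) := by
  obtain ⟨α, σ, -, -, hασ⟩ := h.fourth_moment
  refine ⟨α ^ 2 + σ ^ 4, by positivity, fun i W hW hW4 => ?_⟩
  have error_integrable : Integrable (fun ω => α ^ 2 * ‖wo - W ω‖ ^ 4) P :=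
    (((memLp_const wo).sub hW4).integrable_norm_pow (by norm_num)).const_mul _
  have error_nonneg : 0 ≤ ∫ ω, ‖wo - W ω‖ ^ 4 ∂P := integral_nonneg fun ω => by positivity
  calc ∫ ω, ‖gradNoise J gradHat i ω (W ω)‖ ^ 4 ∂P
      = ∫ ω, (P[fun ω => ‖gradNoise J gradHat i ω (W ω)‖ ^ 4 | ℱ i]) ω ∂P :=
        (integral_condExp (ℱ.le i)).symm
    _ ≤ ∫ ω, (α ^ 2 * ‖wo - W ω‖ ^ 4 + σ ^ 4) ∂P :=
        integral_mono_ae integrable_condExp (error_integrable.add (integrable_const _))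
          (hασ i W hW hW4)
    _ = α ^ 2 * ∫ ω, ‖wo - W ω‖ ^ 4 ∂P + σ ^ 4 := by
        rw [integral_add error_integrable (integrable_const _), integral_const_mul]
        simp only [integral_const, probReal_univ, one_smul]
    _ ≤ (α ^ 2 + σ ^ 4) * (∫ ω, ‖wo - W ω‖ ^ 4 ∂P + 1) := by
        have := mul_nonneg (by positivity : 0 ≤ σ ^ 4) error_nonneg
        linarith [sq_nonneg α]

theorem isNoisyRecursion_networkError (hgroup : IsGrouping nbr group wo)
    (hA : IsCombination nbr group A) (hcost : CostAssumption group J wo)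
    (hnoise : NoiseAssumption P ℱ J wo gradHat Rs) (μ : Fin N → ℝ) :
    IsNoisyRecursion P ℱ (blockMap A.transpose)
      (fun z => blockMap (Matrix.diagonal μ) (gradError J wo z))
      (fun x => networkError nbr group A gradHat wo (x.1 • μ) x.2)
      (fun x ω => blockMap (Matrix.diagonal μ)
        (gradNoise J gradHat x.2 ω (diffusion nbr group A gradHat (x.1 • μ) x.2 ω))) := by
  obtain ⟨C, hC0, hC⟩ := hcost.exists_norm_gradError_le
  obtain ⟨K, hK0, hK⟩ := hnoise.exists_integral_norm_gradNoise_pow_four_le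
  set D : NetVec N M →L[ℝ] NetVec N M := blockMap (Matrix.diagonal μ)
  have diffusion_measurable (x : ℝ × ℕ) :=
    (diffusion_stronglyMeasurable_memLp hA hcost hnoise (x.1 • μ) x.2).1
  have diffusion_memLp (x : ℝ × ℕ) :=
    (diffusion_stronglyMeasurable_memLp hA hcost hnoise (x.1 • μ) x.2).2
  have noise_memLp (x : ℝ × ℕ) :=
    (hnoise.measurable x.2 _ (diffusion_measurable x) (diffusion_memLp x)).2
  refine
    { drift_continuous := D.continuous.comp hcost.continuous_gradError
      exists_norm_drift_le := ⟨‖D‖ * C, by positivity, fun z => ?_⟩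
      step := fun t i ω => networkError_smul_succ hgroup hA J t i ω
      stronglyMeasurable := fun x => stronglyMeasurable_const.sub (diffusion_measurable x)
      memLp := fun x => memLp_networkError hA hcost hnoise _ _
      noise_memLp := fun x => D.comp_memLp' (noise_memLp x)
      noise_condExp := fun x => ?_
      exists_noise_fourth_le := ⟨‖D‖ ^ 4 * K, by positivity, fun x => ?_⟩ }
  · rw [mul_assoc]
    exact (D.le_opNorm _).trans (by gcongr; exact hC z)
  · simpa only [one_smul] using condExp_clm_smul_eq_zero D 1
      ((noise_memLp x).integrable (by norm_num))
      (hnoise.martingale_difference x.2 _ (diffusion_measurable x) (diffusion_memLp x))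
  · refine (integral_norm_pow_le_mul ((noise_memLp x).integrable_norm_pow (by norm_num))
      fun ω => D.le_opNorm _).trans ?_
    rw [mul_assoc]
    gcongr
    exact hK x.2 _ (diffusion_measurable x) (diffusion_memLp x)

theorem isBigO_lpNorm_networkError_four_sq (hgroup : IsGrouping nbr group wo)
    (hA : IsCombination nbr group A) (hp : IsPerronVector group A p)
    (hcost : CostAssumption group J wo) (hnoise : NoiseAssumption P ℱ J wo gradHat Rs)
    (hμ : ∀ k, 0 < μ k) :
    (fun x : ℝ × ℕ => lpNorm (networkError nbr group A gradHat wo (x.1 • μ) x.2) 4 P ^ 2)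
      =O[steadyState] fun x => x.1 := by
  obtain ⟨lam, hlam, hlam_pos, hinner⟩ := hcost.exists_inner_gradError_le
  obtain ⟨C, -, hC⟩ := hcost.exists_norm_gradError_le
  obtain ⟨c, hc, hcontr⟩ := exists_drift_contraction hgroup hA hp hμ hlam hlam_pos hC hinner
  obtain ⟨β, -, hβ⟩ := exists_norm_le_mul_norm_sqrtScale
    (E := EuclideanSpace ℝ (Fin M)) (hp.pos hgroup hA)
  exact (isNoisyRecursion_networkError hgroup hA hcost hnoise μ).isBigO_lpNorm_four_sq hc hβ hcontr

theorem isBigO_lpNorm_groupDeviation_networkError (hgroup : IsGrouping nbr group wo)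
    (hA : IsCombination nbr group A) (hp : IsPerronVector group A p)
    (hcost : CostAssumption group J wo) (hnoise : NoiseAssumption P ℱ J wo gradHat Rs)
    (hμ : ∀ k, 0 < μ k) :
    (fun x : ℝ × ℕ => lpNorm (fun ω =>
      groupDeviation group p (networkError nbr group A gradHat wo (x.1 • μ) x.2 ω)) 2 P)
      =O[steadyState] fun x => x.1 := by
  have hrec := isNoisyRecursion_networkError hgroup hA hcost hnoise μ
  have hz := isBigO_lpNorm_networkError_four_sq hgroup hA hp hcost hnoise hμ
  obtain ⟨r, hr0, hr1, hr⟩ := exists_deviation_contraction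
    (E := EuclideanSpace ℝ (Fin M)) hgroup hA hp
  obtain ⟨β, hβ0, hβ⟩ := exists_norm_le_mul_norm_sqrtScale
    (E := EuclideanSpace ℝ (Fin M)) (hp.pos hgroup hA)
  set R : NetVec N M →L[ℝ] NetVec N M := sqrtScale p ∘L groupDeviation group p
  have scaled_isBigO := hrec.isBigO_lpNorm_two_of_contraction hz (R := R) hr0 hr1 hr
  refine .trans (.of_bound β (.of_forall fun x => ?_)) scaled_isBigO
  rw [Real.norm_of_nonneg lpNorm_nonneg, Real.norm_of_nonneg lpNorm_nonneg]
  exact lpNorm_le_mul_lpNorm (R.comp_memLp' (hrec.memLp_two x)) hβ0 fun ω => hβ _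

end Diffusion

/-! ### Functionals of the group means -/

section GroupFunctional

variable {N G : ℕ} {E : Type*} [NormedAddCommGroup E] [InnerProductSpace ℝ E]
  {group : Fin N → Fin G} {p : Fin N → ℝ}

/-- The component along `u` of the `p`-weighted mean over group `m`. -/
noncomputable def groupFunctional (group : Fin N → Fin G) (p : Fin N → ℝ) (m : Fin G) (u : E) :
    BlockVec N E →L[ℝ] ℝ :=
  ∑ k ∈ groupAgents group m, p k • innerSL ℝ u ∘L PiLp.proj 2 (fun _ => E) k

theorem groupFunctional_apply (m : Fin G) (u : E) (z : BlockVec N E) :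
    groupFunctional group p m u z = ∑ k ∈ groupAgents group m, p k * inner ℝ u (z k) := by
  simp [groupFunctional]

theorem groupFunctional_eq_inner (k : Fin N) (u : E) (z : BlockVec N E) :
    groupFunctional group p (group k) u z = inner ℝ u (blockMap (groupMean group p) z k) := by
  simp_rw [groupFunctional_apply, blockMap_apply, inner_sum, groupAgents, Finset.sum_filter,
    groupMean_apply, real_inner_smul_right, ite_mul, zero_mul]

theorem groupFunctional_combine {nbr : Fin N → Finset (Fin N)} {A : Matrix (Fin N) (Fin N) ℝ}
    (hA : IsCombination nbr group A) (hp : IsPerronVector group A p) (m : Fin G) (u : E)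
    (z : BlockVec N E) :
    groupFunctional group p m u (blockMap A.transpose z) = groupFunctional group p m u z := by
  obtain ⟨k, rfl⟩ := hp.exists_group_eq m
  rw [groupFunctional_eq_inner, groupFunctional_eq_inner, ← blockMap_mul,
    groupMean_mul_transpose hA hp]

theorem norm_groupMean_sq {ι : Type*} [Fintype ι] (b : Fin G → OrthonormalBasis ι ℝ E)
    (z : BlockVec N E) : ‖blockMap (groupMean group p) z‖ ^ 2 =
      ∑ m, ((groupAgents group m).card : ℝ) * ∑ a, groupFunctional group p m (b m a) z ^ 2 := by
  rw [PiLp.norm_sq_eq_of_L2,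
    ← Finset.sum_fiberwise Finset.univ group fun k => ‖blockMap (groupMean group p) z k‖ ^ 2]
  refine Finset.sum_congr rfl fun m _ => ?_
  rw [← nsmul_eq_mul]
  refine Finset.sum_eq_card_nsmul fun k hk => ?_
  obtain rfl : group k = m := (Finset.mem_filter.1 hk).2
  simp_rw [← (b (group k)).sum_sq_norm_inner_right, groupFunctional_eq_inner, Real.norm_eq_abs,
    sq_abs]

variable {H : Fin N → E →L[ℝ] E} {μ : Fin N → ℝ} {m : Fin G} {u : E} {lam : ℝ}

theorem groupFunctional_diagonal_add_eq_sum (hH : ∀ k, (H k : E →ₗ[ℝ] E).IsSymmetric)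
    (hu : ∑ k ∈ groupAgents group m, (p k * μ k) • H k u = lam • u) (y z : BlockVec N E) :
    groupFunctional group p m u (blockMap (Matrix.diagonal μ) y) +
        lam * groupFunctional group p m u z =
      ∑ k ∈ groupAgents group m,
        p k * μ k * inner ℝ u (y k + H k (z k) - H k (groupDeviation group p z k)) := by
  have eigen : lam * groupFunctional group p m u z = ∑ k ∈ groupAgents group m,
      p k * μ k * inner ℝ u (H k (blockMap (groupMean group p) z k)) := by
    rcases (groupAgents group m).eq_empty_or_nonempty with hm | ⟨l, hl⟩
    · simp [groupFunctional_apply, hm]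
    obtain rfl : group l = m := (Finset.mem_filter.1 hl).2
    rw [groupFunctional_eq_inner, ← real_inner_smul_left, ← hu, sum_inner]
    refine Finset.sum_congr rfl fun k hk => ?_
    rw [real_inner_smul_left, blockMap_groupMean_congr (Finset.mem_filter.1 hk).2.symm]
    exact congrArg _ (hH k _ _)
  rw [eigen, groupFunctional_apply, ← Finset.sum_add_distrib]
  refine Finset.sum_congr rfl fun k _ => ?_
  rw [blockMap_diagonal, real_inner_smul_right, groupDeviation_apply, PiLp.sub_apply, map_sub,
    inner_sub_right, inner_sub_right, inner_add_right]
  ring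

theorem exists_abs_groupFunctional_drift_le (hp : ∀ k, 0 ≤ p k) (hμ : ∀ k, 0 ≤ μ k)
    (hH : ∀ k, (H k : E →ₗ[ℝ] E).IsSymmetric)
    (hu : ∑ k ∈ groupAgents group m, (p k * μ k) • H k u = lam • u)
    {g : BlockVec N E → BlockVec N E} {κ : ℝ} (hκ : 0 ≤ κ)
    (hg : ∀ z k, ‖g z k + H k (z k)‖ ≤ κ * ‖z k‖ ^ 2) :
    ∃ C, ∀ z, |groupFunctional group p m u (blockMap (Matrix.diagonal μ) (g z)) +
      lam * groupFunctional group p m u z| ≤ C * (‖groupDeviation group p z‖ + ‖z‖ ^ 2) := by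
  refine ⟨∑ k ∈ groupAgents group m, p k * μ k * (‖u‖ * (κ + ‖H k‖)), fun z => ?_⟩
  rw [groupFunctional_diagonal_add_eq_sum hH hu, Finset.sum_mul]
  refine (Finset.abs_sum_le_sum_abs _ _).trans (Finset.sum_le_sum fun k _ => ?_)
  have weight_nonneg := mul_nonneg (hp k) (hμ k)
  have curvature_le : ‖g z k + H k (z k)‖ ≤ κ * ‖z‖ ^ 2 :=
    (hg z k).trans (by gcongr; exact PiLp.norm_apply_le z k)
  have deviation_le : ‖H k (groupDeviation group p z k)‖ ≤ ‖H k‖ * ‖groupDeviation group p z‖ :=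
    ((H k).le_opNorm _).trans (by gcongr; exact PiLp.norm_apply_le _ k)
  rw [abs_mul, abs_of_nonneg weight_nonneg, mul_assoc (p k * μ k), mul_assoc ‖u‖]
  gcongr
  refine (abs_real_inner_le_norm _ _).trans ?_
  gcongr
  calc ‖g z k + H k (z k) - H k (groupDeviation group p z k)‖
      ≤ κ * ‖z‖ ^ 2 + ‖H k‖ * ‖groupDeviation group p z‖ :=
        norm_sub_le_of_le curvature_le deviation_le
    _ ≤ (κ + ‖H k‖) * (‖groupDeviation group p z‖ + ‖z‖ ^ 2) := by
        have : 0 ≤ κ * ‖groupDeviation group p z‖ := by positivity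
        have : 0 ≤ ‖H k‖ * ‖z‖ ^ 2 := by positivity
        linarith

end GroupFunctional

/-! ### Group Hessians and group covariances -/

section Spectral

variable {n : Type*} [Fintype n]

theorem trace_eq_sum_dotProduct_mulVec (b : OrthonormalBasis n ℝ (EuclideanSpace ℝ n))
    (B : Matrix n n ℝ) : B.trace = ∑ a, (b a).ofLp ⬝ᵥ B.mulVec (b a).ofLp := by
  classical
  have := LinearMap.trace_eq_sum_inner (Matrix.toEuclideanLin B) b
  rw [Matrix.toEuclideanLin_eq_toLin_orthonormal, Matrix.trace_toLin_eq] at this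
  rw [this]
  exact Finset.sum_congr rfl fun a _ => Matrix.inner_toEuclideanCLM B _ _

theorem trace_inv_mul_eq_sum [DecidableEq n] {H : Matrix n n ℝ} (hH : H.PosDef) (R : Matrix n n ℝ) :
    (H⁻¹ * R).trace = ∑ a, ((hH.1.eigenvectorBasis a).ofLp ⬝ᵥ
      R.mulVec (hH.1.eigenvectorBasis a).ofLp) / hH.1.eigenvalues a := by
  have inv_mulVec (a : n) : H⁻¹.mulVec (hH.1.eigenvectorBasis a).ofLp =
      (hH.1.eigenvalues a)⁻¹ • (hH.1.eigenvectorBasis a).ofLp := by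
    rw [eq_inv_smul_iff₀ (hH.eigenvalues_pos a).ne', ← Matrix.mulVec_smul,
      ← hH.1.mulVec_eigenvectorBasis, Matrix.mulVec_mulVec,
      Matrix.nonsing_inv_mul H hH.det_pos.ne'.isUnit, Matrix.one_mulVec]
  rw [Matrix.trace_mul_comm, trace_eq_sum_dotProduct_mulVec hH.1.eigenvectorBasis]
  refine Finset.sum_congr rfl fun a _ => ?_
  rw [← Matrix.mulVec_mulVec, inv_mulVec, Matrix.mulVec_smul, dotProduct_smul, smul_eq_mul,
    inv_mul_eq_div]

end Spectral

section Group

variable {N M G : ℕ} {group : Fin N → Fin G} {J : Fin N → EuclideanSpace ℝ (Fin M) → ℝ}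
  {wo : NetVec N M} {p μ : Fin N → ℝ}

/-- The weighted Hessian `∑_{k ∈ G_m} p_k μ_k H_k` of group `m`. -/
noncomputable def groupHessian (group : Fin N → Fin G) (J : Fin N → EuclideanSpace ℝ (Fin M) → ℝ)
    (wo : NetVec N M) (p μ : Fin N → ℝ) (m : Fin G) : Matrix (Fin M) (Fin M) ℝ :=
  ∑ k ∈ groupAgents group m, (p k * μ k) • hessianMatrix (J k) (wo k)

/-- The weighted noise covariance `∑_{k, l ∈ G_m} p_k p_l μ_k μ_l R_{kl}` of group `m`. -/
noncomputable def groupCov (group : Fin N → Fin G) (Rs : NetMat N M) (p μ : Fin N → ℝ)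
    (m : Fin G) : Matrix (Fin M) (Fin M) ℝ :=
  ∑ k ∈ groupAgents group m, ∑ l ∈ groupAgents group m,
    (p k * p l * (μ k * μ l)) • Rs.block k l

theorem CostAssumption.posDef_groupHessian (h : CostAssumption group J wo) (hp : ∀ k, 0 < p k)
    (hμ : ∀ k, 0 < μ k) (m : Fin G) : (groupHessian group J wo p μ m).PosDef := by
  obtain ⟨k, hk, posDef⟩ := h.exists_posDef_hessianMatrix m
  rw [groupHessian, ← Finset.add_sum_erase _ _ hk]
  exact ((posDef _).smul (mul_pos (hp k) (hμ k))).add_posSemidef <|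
    Matrix.posSemidef_sum _ fun l _ =>
      (h.posSemidef_hessianMatrix l _).smul (mul_pos (hp l) (hμ l)).le

theorem toEuclideanCLM_groupHessian (m : Fin G) (v : EuclideanSpace ℝ (Fin M)) :
    Matrix.toEuclideanCLM (𝕜 := ℝ) (groupHessian group J wo p μ m) v =
      ∑ k ∈ groupAgents group m,
        (p k * μ k) • Matrix.toEuclideanCLM (𝕜 := ℝ) (hessianMatrix (J k) (wo k)) v := by
  simp only [groupHessian, map_sum, map_smul, sum_apply, smul_apply]

/-- The coefficients of the functional `s ↦ ⟨u, ∑_{k ∈ G_m} p_k μ_k s_k⟩` of the network noise. -/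
noncomputable def groupCoeff (group : Fin N → Fin G) (p μ : Fin N → ℝ) (m : Fin G)
    (u : EuclideanSpace ℝ (Fin M)) (x : Fin N × Fin M) : ℝ :=
  (if group x.1 = m then p x.1 * μ x.1 else 0) * u x.2

theorem groupFunctional_diagonal_eq_sum (m : Fin G) (u : EuclideanSpace ℝ (Fin M))
    (s : NetVec N M) :
    groupFunctional group p m u (blockMap (Matrix.diagonal μ) s) =
      ∑ x, groupCoeff group p μ m u x * s x.1 x.2 := by
  rw [groupFunctional_apply, groupAgents, Finset.sum_filter, Fintype.sum_prod_type]
  refine Finset.sum_congr rfl fun k _ => ?_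
  simp only [groupCoeff, mul_assoc]
  rw [← Finset.mul_sum, blockMap_diagonal, real_inner_smul_right, PiLp.inner_apply, ← mul_assoc,
    ite_mul, zero_mul]
  simp only [RCLike.inner_apply, conj_trivial, mul_comm]

theorem dotProduct_mulVec_eq_sum_block (R : NetMat N M) (c : Fin N × Fin M → ℝ) :
    c ⬝ᵥ R.mulVec c =
      ∑ k, ∑ l, (fun a => c (k, a)) ⬝ᵥ (R.block k l).mulVec (fun a => c (l, a)) := by
  simp only [dotProduct, Matrix.mulVec, Fintype.sum_prod_type, Finset.mul_sum, NetMat.block,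
    Matrix.of_apply]
  exact Finset.sum_congr rfl fun k _ => Finset.sum_comm

theorem groupCoeff_dotProduct_mulVec (Rs : NetMat N M) (m : Fin G)
    (u : EuclideanSpace ℝ (Fin M)) :
    groupCoeff group p μ m u ⬝ᵥ Rs.mulVec (groupCoeff group p μ m u) =
      u.ofLp ⬝ᵥ (groupCov group Rs p μ m).mulVec u.ofLp := by
  have block (k : Fin N) : (fun a => groupCoeff group p μ m u (k, a)) =
      (if group k = m then p k * μ k else 0) • u.ofLp := rfl
  simp_rw [dotProduct_mulVec_eq_sum_block, block, Matrix.mulVec_smul, smul_dotProduct,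
    dotProduct_smul, groupCov, Matrix.sum_mulVec, dotProduct_sum, Matrix.smul_mulVec,
    dotProduct_smul, groupAgents, Finset.sum_filter, smul_eq_mul]
  refine Finset.sum_congr rfl fun k _ => ?_
  split_ifs with hk
  · refine Finset.sum_congr rfl fun l _ => ?_
    split_ifs <;> ring
  · simp

theorem stepMax_smul {t : ℝ} (ht : 0 ≤ t) : stepMax (t • μ) = t * stepMax μ :=
  (Real.mul_iSup_of_nonneg ht _).symm

theorem groupMSDSumCross_eq_div (Rs : NetMat N M) :
    groupMSDSumCross group J wo Rs p μ =
      (∑ m, ((groupAgents group m).card : ℝ) / 2 *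
        ((groupHessian group J wo p μ m)⁻¹ * groupCov group Rs p μ m).trace) / stepMax μ := by
  rw [groupMSDSumCross, Finset.sum_div]
  refine Finset.sum_congr rfl fun m _ => ?_
  rw [groupHessian, groupCov]
  ring

theorem groupMSDSumCross_eq_groupMSDSum {Rs : NetMat N M}
    (h : ∀ k l, k ≠ l → group k = group l → Rs.block k l = 0) :
    groupMSDSumCross group J wo Rs p μ = groupMSDSum group J wo Rs p μ := by
  refine Finset.sum_congr rfl fun m _ => ?_
  congr 3
  refine Finset.sum_congr rfl fun k hk => ?_
  rw [Finset.sum_eq_single_of_mem k hk, sq, sq]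
  intro l hl hlk
  rw [h k l hlk.symm ((Finset.mem_filter.1 hk).2.trans (Finset.mem_filter.1 hl).2.symm), smul_zero]

end Group

/-! ### Steady-state limits -/

theorem toEuclideanCLM_eigenvectorBasis {n : Type*} [Fintype n] [DecidableEq n]
    {H : Matrix n n ℝ} (hH : H.IsHermitian) (a : n) :
    Matrix.toEuclideanCLM (𝕜 := ℝ) H (hH.eigenvectorBasis a) =
      hH.eigenvalues a • hH.eigenvectorBasis a :=
  PiLp.ext fun b => by rw [Matrix.ofLp_toEuclideanCLM, hH.mulVec_eigenvectorBasis]; rfl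

section Limits

variable {N M G : ℕ} {Ω : Type*} [mΩ : MeasurableSpace Ω] {P : Measure Ω}
  {ℱ : Filtration ℕ mΩ} {nbr : Fin N → Finset (Fin N)} {group : Fin N → Fin G}
  {J : Fin N → EuclideanSpace ℝ (Fin M) → ℝ} {wo : NetVec N M} {A : Matrix (Fin N) (Fin N) ℝ}
  {gradHat : ℕ → Fin N → Ω → EuclideanSpace ℝ (Fin M) → EuclideanSpace ℝ (Fin M)}
  {Rs : NetMat N M} {p μ : Fin N → ℝ}

theorem normalizedMSD_eq_zero [IsEmpty (Fin N)] :
    normalizedMSD P nbr group A gradHat wo μ = 0 := by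
  have error_eq_zero (i : ℕ) (ω : Ω) : wo - diffusion nbr group A gradHat μ i ω = 0 :=
    PiLp.ext isEmptyElim
  simp [normalizedMSD, error_eq_zero]

variable [IsProbabilityMeasure P]

theorem tendsto_integral_groupFunctional_noise_sq (hgroup : IsGrouping nbr group wo)
    (hA : IsCombination nbr group A) (hp : IsPerronVector group A p)
    (hcost : CostAssumption group J wo) (hnoise : NoiseAssumption P ℱ J wo gradHat Rs)
    (hμ : ∀ k, 0 < μ k) (m : Fin G) (u : EuclideanSpace ℝ (Fin M)) :
    Tendsto (fun x : ℝ × ℕ => ∫ ω, groupFunctional group p m u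
        (blockMap (Matrix.diagonal μ) (gradNoise J gradHat x.2 ω
          (diffusion nbr group A gradHat (x.1 • μ) x.2 ω))) ^ 2 ∂P)
      steadyState (𝓝 (u.ofLp ⬝ᵥ (groupCov group Rs p μ m).mulVec u.ofLp)) := by
  have state (x : ℝ × ℕ) := diffusion_stronglyMeasurable_memLp hA hcost hnoise (x.1 • μ) x.2
  simp_rw [groupFunctional_diagonal_eq_sum, ← groupCoeff_dotProduct_mulVec]
  exact hnoise.tendsto_integral_sq_gradNoise (fun x => (state x).1) (fun x => (state x).2)
    (tendsto_zero_of_sq_isBigO_fst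
      (isBigO_lpNorm_networkError_four_sq hgroup hA hp hcost hnoise hμ)) _

theorem tendsto_integral_groupFunctional_sq_div (hgroup : IsGrouping nbr group wo)
    (hA : IsCombination nbr group A) (hp : IsPerronVector group A p)
    (hcost : CostAssumption group J wo) (hnoise : NoiseAssumption P ℱ J wo gradHat Rs)
    (hμ : ∀ k, 0 < μ k) {m : Fin G} {u : EuclideanSpace ℝ (Fin M)} {lam : ℝ} (hlam : 0 < lam)
    (hu : Matrix.toEuclideanCLM (𝕜 := ℝ) (groupHessian group J wo p μ m) u = lam • u) :
    Tendsto (fun x : ℝ × ℕ => (∫ ω, groupFunctional group p m u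
        (networkError nbr group A gradHat wo (x.1 • μ) x.2 ω) ^ 2 ∂P) / x.1)
      steadyState
      (𝓝 ((u.ofLp ⬝ᵥ (groupCov group Rs p μ m).mulVec u.ofLp) / (2 * lam))) := by
  have hrec := isNoisyRecursion_networkError hgroup hA hcost hnoise μ
  have hz := isBigO_lpNorm_networkError_four_sq hgroup hA hp hcost hnoise hμ
  have hdeviation := isBigO_lpNorm_groupDeviation_networkError hgroup hA hp hcost hnoise hμ
  obtain ⟨κ, hκ, hgradError⟩ := hcost.exists_norm_gradError_add_le
  have hessian_isSymmetric (k : Fin N) : (Matrix.toEuclideanCLM (𝕜 := ℝ)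
      (hessianMatrix (J k) (wo k)) : EuclideanSpace ℝ (Fin M) →ₗ[ℝ] _).IsSymmetric :=
    Matrix.isSymmetric_toEuclideanLin_iff.2 (hcost.posSemidef_hessianMatrix k _).1
  obtain ⟨C, hC⟩ := exists_abs_groupFunctional_drift_le (fun k => (hp.pos hgroup hA k).le)
    (fun k => (hμ k).le) hessian_isSymmetric ((toEuclideanCLM_groupHessian m u).symm.trans hu)
    hκ hgradError
  exact hrec.tendsto_integral_functional_sq_div hz (groupFunctional_combine hA hp m u) hlam
    (hrec.isBigO_lpNorm_defect hz hdeviation hC)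
    (tendsto_integral_groupFunctional_noise_sq hgroup hA hp hcost hnoise hμ m u)

theorem tendsto_integral_norm_groupMean_sq_div (hgroup : IsGrouping nbr group wo)
    (hA : IsCombination nbr group A) (hp : IsPerronVector group A p)
    (hcost : CostAssumption group J wo) (hnoise : NoiseAssumption P ℱ J wo gradHat Rs)
    (hμ : ∀ k, 0 < μ k) :
    Tendsto (fun x : ℝ × ℕ => (∫ ω, ‖blockMap (groupMean group p)
        (networkError nbr group A gradHat wo (x.1 • μ) x.2 ω)‖ ^ 2 ∂P) / x.1)
      steadyState (𝓝 (∑ m, ((groupAgents group m).card : ℝ) / 2 *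
        ((groupHessian group J wo p μ m)⁻¹ * groupCov group Rs p μ m).trace)) := by
  have posDef := hcost.posDef_groupHessian (hp.pos hgroup hA) hμ
  have functional_memLp (m u) (x : ℝ × ℕ) : MemLp (fun ω => groupFunctional group p m u
      (networkError nbr group A gradHat wo (x.1 • μ) x.2 ω)) 2 P :=
    (groupFunctional group p m u).comp_memLp'
      ((isNoisyRecursion_networkError hgroup hA hcost hnoise μ).memLp_two x)
  have decomposition (x : ℝ × ℕ) : (∫ ω, ‖blockMap (groupMean group p)
        (networkError nbr group A gradHat wo (x.1 • μ) x.2 ω)‖ ^ 2 ∂P) / x.1 =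
      ∑ m, ((groupAgents group m).card : ℝ) * ∑ a, (∫ ω, groupFunctional group p m
        ((posDef m).1.eigenvectorBasis a)
        (networkError nbr group A gradHat wo (x.1 • μ) x.2 ω) ^ 2 ∂P) / x.1 := by
    simp_rw [norm_groupMean_sq fun m => (posDef m).1.eigenvectorBasis]
    rw [integral_finsetSum _ fun m _ => (integrable_finsetSum _ fun a _ =>
      (functional_memLp m _ x).integrable_sq).const_mul _, Finset.sum_div]
    refine Finset.sum_congr rfl fun m _ => ?_
    rw [integral_const_mul, integral_finsetSum _ fun a _ =>
      (functional_memLp m _ x).integrable_sq, mul_div_assoc, Finset.sum_div]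
  simp_rw [decomposition, trace_inv_mul_eq_sum (posDef _), div_mul_eq_mul_div, mul_div_assoc,
    Finset.sum_div, div_div, mul_comm _ (2 : ℝ)]
  exact tendsto_finsetSum _ fun m _ => (tendsto_finsetSum _ fun a _ =>
    tendsto_integral_groupFunctional_sq_div hgroup hA hp hcost hnoise hμ
      ((posDef m).eigenvalues_pos a) (toEuclideanCLM_eigenvectorBasis _ a)).const_mul _

theorem tendsto_integral_norm_networkError_sq_div (hgroup : IsGrouping nbr group wo)
    (hA : IsCombination nbr group A) (hp : IsPerronVector group A p)
    (hcost : CostAssumption group J wo) (hnoise : NoiseAssumption P ℱ J wo gradHat Rs)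
    (hμ : ∀ k, 0 < μ k) :
    Tendsto (fun x : ℝ × ℕ =>
        (∫ ω, ‖networkError nbr group A gradHat wo (x.1 • μ) x.2 ω‖ ^ 2 ∂P) / x.1)
      steadyState (𝓝 (∑ m, ((groupAgents group m).card : ℝ) / 2 *
        ((groupHessian group J wo p μ m)⁻¹ * groupCov group Rs p μ m).trace)) :=
  have hrec := isNoisyRecursion_networkError hgroup hA hcost hnoise μ
  hrec.tendsto_integral_norm_sq_div_of_sub_isBigO
    (isBigO_lpNorm_networkError_four_sq hgroup hA hp hcost hnoise hμ)
    (isBigO_lpNorm_groupDeviation_networkError hgroup hA hp hcost hnoise hμ)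
    (tendsto_integral_norm_groupMean_sq_div hgroup hA hp hcost hnoise hμ)

theorem normalizedMSD_eq_limsup
    (hW : ∀ i, MemLp (networkError nbr group A gradHat wo μ i) 4 P) (hμ : 0 < stepMax μ) :
    normalizedMSD P nbr group A gradHat wo μ = limsup (fun i => ENNReal.ofReal
      ((∫ ω, ‖networkError nbr group A gradHat wo μ i ω‖ ^ 2 ∂P) / stepMax μ)) atTop := by
  refine congrArg (limsup · atTop) (funext fun i => ?_)
  have integrable_sq := ((hW i).mono_exponent (p := 2) (by norm_num)).integrable_norm_pow
    two_ne_zero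
  rw [ENNReal.ofReal_div_of_pos hμ, ENNReal.div_eq_inv_mul,
    ofReal_integral_eq_lintegral_ofReal integrable_sq (ae_of_all _ fun ω => sq_nonneg _)]
  simp_rw [ENNReal.ofReal_pow (norm_nonneg _), ofReal_norm, networkError]

theorem tendsto_normalizedMSD [Nonempty (Fin N)] (hgroup : IsGrouping nbr group wo)
    (hA : IsCombination nbr group A) (hp : IsPerronVector group A p)
    (hcost : CostAssumption group J wo) (hnoise : NoiseAssumption P ℱ J wo gradHat Rs)
    (hμ : ∀ k, 0 < μ k) :
    Tendsto (fun t : ℝ => normalizedMSD P nbr group A gradHat wo (t • μ)) (𝓝[>] 0)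
      (𝓝 (ENNReal.ofReal (groupMSDSumCross group J wo Rs p μ))) := by
  obtain ⟨k⟩ := ‹Nonempty (Fin N)›
  have stepMax_pos : 0 < stepMax μ := (hμ k).trans_le (le_ciSup (Set.finite_range μ).bddAbove k)
  have limit : Tendsto (fun x : ℝ × ℕ => ENNReal.ofReal
      ((∫ ω, ‖networkError nbr group A gradHat wo (x.1 • μ) x.2 ω‖ ^ 2 ∂P) / x.1 / stepMax μ))
      steadyState (𝓝 (ENNReal.ofReal (groupMSDSumCross group J wo Rs p μ))) := by
    rw [groupMSDSumCross_eq_div]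
    exact ENNReal.tendsto_ofReal
      ((tendsto_integral_norm_networkError_sq_div hgroup hA hp hcost hnoise hμ).div_const _)
  refine (tendsto_limsup_of_tendsto_curry limit).congr' ?_
  filter_upwards [self_mem_nhdsWithin] with t ht
  have stepMax_eq : stepMax (t • μ) = t * stepMax μ := stepMax_smul (Set.mem_Ioi.1 ht).le
  rw [normalizedMSD_eq_limsup (memLp_networkError hA hcost hnoise _)
    (stepMax_eq ▸ mul_pos ht stepMax_pos), stepMax_eq]
  simp_rw [div_div]

end Limits

theorem mainTheorem5 {N M G : ℕ} {Ω : Type*} [mΩ : MeasurableSpace Ω]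
    (P : Measure Ω) [IsProbabilityMeasure P] (ℱ : Filtration ℕ mΩ)
    (nbr : Fin N → Finset (Fin N)) (group : Fin N → Fin G)
    (J : Fin N → EuclideanSpace ℝ (Fin M) → ℝ) (wo : NetVec N M)
    (A : Matrix (Fin N) (Fin N) ℝ) (p : Fin N → ℝ)
    (gradHat : ℕ → Fin N → Ω → EuclideanSpace ℝ (Fin M) → EuclideanSpace ℝ (Fin M))
    (Rs : NetMat N M)
    (hgroup : IsGrouping nbr group wo)
    (hcost : CostAssumption group J wo)
    (hA : IsCombination nbr group A)
    (hp : IsPerronVector group A p)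
    (hnoise : NoiseAssumption P ℱ J wo gradHat Rs)
    (μ : Fin N → ℝ) (hμ : ∀ k, 0 < μ k) :
    Tendsto (fun t : ℝ => normalizedMSD P nbr group A gradHat wo (t • μ)) (𝓝[>] 0)
        (𝓝 (ENNReal.ofReal (groupMSDSumCross group J wo Rs p μ))) ∧
      ((∀ k l, k ≠ l → group k = group l → Rs.block k l = 0) →
        Tendsto (fun t : ℝ => normalizedMSD P nbr group A gradHat wo (t • μ)) (𝓝[>] 0)
          (𝓝 (ENNReal.ofReal (groupMSDSum group J wo Rs p μ)))) := by
  have cross_limit : Tendsto (fun t : ℝ => normalizedMSD P nbr group A gradHat wo (t • μ))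
      (𝓝[>] 0) (𝓝 (ENNReal.ofReal (groupMSDSumCross group J wo Rs p μ))) := by
    cases isEmpty_or_nonempty (Fin N)
    · have sum_eq_zero : groupMSDSumCross group J wo Rs p μ = 0 := by
        simp [groupMSDSumCross, stepMax]
      simp_rw [sum_eq_zero, normalizedMSD_eq_zero, ENNReal.ofReal_zero]
      exact tendsto_const_nhds
    · exact tendsto_normalizedMSD hgroup hA hp hcost hnoise hμ
  exact ⟨cross_limit, fun uncorrelated =>
    groupMSDSumCross_eq_groupMSDSum uncorrelated ▸ cross_limit⟩
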